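/- Let $p\ge 3$ be an integer. All graphs are finite, simple and undirected. For a graph $G$ and $X\subseteq V(G)$, $N_G(x)$ is the set of neighbours of $x$, and $L(G)$ is the set of leaves (vertices of degree one) of $G$. A set $D\subseteq V(G)$ is *$p$-dominating* if every vertex of $V(G)\setminus D$ has at least $p$ neighbours in $D$; $\gamma_p(G)$ is the minimum cardinality of such a set, and a *$\gamma_p(G)$-set* is a $p$-dominating set of that cardinality. The *$p$-reinforcement number* $r_p(G)$ is $0$ if $\gamma_p(G)\le p$, and otherwise it is the minimum of $|B|$ over the sets $B$ of edges of the complement of $G$ with $\gamma_p(G+B)<\gamma_p(G)$. For $x\in X$ let $PN_p(x,X,G)=\{y\in V(G)\setminus X : xy\in E(G),\ |N_G(y)\cap X|=p\}$. The *center* of a star $K_{1,t}$ ($t\ge 2$) is its vertex of degree $t$. The tree $F_{p-1}$ is obtained by attaching $p-1$ leaves at each of the two endvertices of a path on three vertices, whose middle vertex is the *center* of $F_{p-1}$. For $t\ge p$ the tree $F_{t,p-1}$ is obtained from $K_{1,t}$ by first attaching one leaf at each of its $t$ endvertices and then attaching $p-1$ leaves at each of the $t$ endvertices of the resulting tree;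 its *center* is the center of $K_{1,t}$. If $T$ has exactly one $\gamma_p(T)$-set, it is denoted $\mathcal D_T$ (this is the case for $F_{p-1}$ and $F_{t,p-1}$). For disjoint graphs $G,H$ with $x\in V(G)$, $y\in V(H)$, $G\uplus_{xy}H$ is the union of $G$ and $H$ together with the extra edge $xy$. The family $\mathscr T_p$ consists, up to isomorphism, of all trees $T=T_k$ obtained from a sequence $T_0,T_1,\dots,T_k$ with $k\ge 1$, where $T_0=K_{1,p}$ with $A(T_0)=L(K_{1,p})$, and each $T_{i+1}$, with its set $A(T_{i+1})$, is obtained from $T_i$ and $A(T_i)$ by one of the following operations. * $\mathscr O_1$: $T_{i+1}=K_{1,p-1}\uplus_{xy}T_i$, where $x$ is the center of $K_{1,p-1}$ and $y\in A(T_i)$; $A(T_{i+1})=L(K_{1,p-1})\cup A(T_i)$. * $\mathscr O_2$: $T_{i+1}=K_{1,p}\uplus_{xy}T_i$, where $x$ is the center of $K_{1,p}$ and $y\in V(T_i)\setminus A(T_i)$; $A(T_{i+1})=L(K_{1,p})\cup A(T_i)$. * $\mathscr O_3$: $T_{i+1}=F_{p-1}\uplus_{xy}T_i$, where $x$ is the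 center of $F_{p-1}$ and $y\in A(T_i)$ satisfies $|PN_p(y,A(T_i),T_i)|\ge\min\{p+1,\ |N_{T_i}(y)\cap A(T_i)|+2\}$; $A(T_{i+1})=\mathcal D_{F_{p-1}}\cup A(T_i)$. * $\mathscr O_4$: $T_{i+1}=F_{t,p-1}\uplus_{xy}T_i$, where $t\ge p$, $x$ is the center of $F_{t,p-1}$ and $y\in V(T_i)$; $A(T_{i+1})=\mathcal D_{F_{t,p-1}}\cup A(T_i)$. **Theorem.** Let $p\ge 3$ be an integer and $T$ a tree. Then $r_p(T)\le p+1$, and $$r_p(T)=p+1\quad\Longleftrightarrow\quad T\in\mathscr T_p .$$ Moreover, if $T\in\mathscr T_p$, then for every such construction of $T$ the set $A(T)$ it produces is the unique $\gamma_p(T)$-set. -/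

import Mathlib

namespace PReinforcement

universe u

/-- `D` is a `p`-dominating set of `G`: every vertex outside `D` has at least `p` neighbours
in `D`. -/
def IsPDominating {V : Type u} (p : ℕ) (G : SimpleGraph V) (D : Set V) : Prop :=
  ∀ v, v ∉ D → p ≤ (G.neighborSet v ∩ D).ncard

/-- The `p`-domination number `γ_p(G)` of a finite graph. -/
noncomputable def domNum {V : Type u} (p : ℕ) (G : SimpleGraph V) : ℕ :=
  sInf {n | ∃ D : Set V, IsPDominating p G D ∧ D.ncard = n}

/-- `D` is a `γ_p(G)`-set: a `p`-dominating set of minimum cardinality. -/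
def IsGammaSet {V : Type u} (p : ℕ) (G : SimpleGraph V) (D : Set V) : Prop :=
  IsPDominating p G D ∧ D.ncard = domNum p G

/-- `D` is the one and only `γ_p(G)`-set. -/
def IsUniqueGammaSet {V : Type u} (p : ℕ) (G : SimpleGraph V) (D : Set V) : Prop :=
  ∀ S : Set V, IsGammaSet p G S ↔ S = D

/-- The `p`-reinforcement number `r_p(G)` of a finite graph: `0` if `γ_p(G) ≤ p`, and otherwise
the least number of edges of the complement whose addition to `G` lowers `γ_p`. -/
noncomputable def reinfNum {V : Type u} (p : ℕ) (G : SimpleGraph V) : ℕ :=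
  open Classical in
  if domNum p G ≤ p then 0
  else sInf {n | ∃ B : Set (Sym2 V), B ⊆ Gᶜ.edgeSet ∧
    domNum p (G ⊔ SimpleGraph.fromEdgeSet B) < domNum p G ∧ B.ncard = n}

/-- The `p`-private neighbourhood `PN_p(x, X, G)` of `x` with respect to `X`. -/
def privateNbrs {V : Type u} (p : ℕ) (G : SimpleGraph V) (X : Set V) (x : V) : Set V :=
  {y | y ∉ X ∧ G.Adj x y ∧ (G.neighborSet y ∩ X).ncard = p}

/-- The set `L(G)` of leaves, that is, of vertices of degree one. -/
def leafSet {V : Type u} (G : SimpleGraph V) : Set V :=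
  {v | (G.neighborSet v).ncard = 1}

/-- The graph obtained from `G` by attaching `m` new leaves at the vertex `f i`, for every
index `i`. -/
def attachLeaves {V ι : Type} (G : SimpleGraph V) (f : ι → V) (m : ℕ) :
    SimpleGraph (V ⊕ (ι × Fin m)) :=
  SimpleGraph.fromRel fun a b => match a, b with
    | Sum.inl u, Sum.inl v => G.Adj u v
    | Sum.inl u, Sum.inr (i, _) => u = f i
    | _, _ => False

/-- The star `K_{1,t}`; its center is `Sum.inl ()`. -/
abbrev starK (t : ℕ) : SimpleGraph (Unit ⊕ Fin t) :=
  completeBipartiteGraph Unit (Fin t)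

/-- The tree `F_m`: attach `m` leaves at both endvertices of the path `P_3`.
Its center is the middle vertex `Sum.inl 1` of the path. -/
abbrev treeF (m : ℕ) : SimpleGraph (Fin 3 ⊕ (Fin 2 × Fin m)) :=
  attachLeaves (SimpleGraph.pathGraph 3) ![0, 2] m

/-- The spider `S_t`: attach one leaf at every endvertex of `K_{1,t}`. -/
abbrev spider (t : ℕ) : SimpleGraph ((Unit ⊕ Fin t) ⊕ (Fin t × Fin 1)) :=
  attachLeaves (starK t) Sum.inr 1

/-- The tree `F_{t,m}`: attach `m` leaves at every endvertex of the spider `S_t`.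
Its center is the center `Sum.inl (Sum.inl (Sum.inl ()))` of the spider. -/
abbrev treeF₂ (t m : ℕ) :
    SimpleGraph (((Unit ⊕ Fin t) ⊕ (Fin t × Fin 1)) ⊕ (Fin t × Fin m)) :=
  attachLeaves (spider t) (fun i => Sum.inr (i, 0)) m

/-- `G ⊎_{xy} H`: the disjoint union of `G` and `H` with the extra edge `xy`. -/
abbrev joinEdge {V W : Type} (G : SimpleGraph V) (H : SimpleGraph W) (x : V) (y : W) :
    SimpleGraph (V ⊕ W) :=
  (G.sum H) ⊔ SimpleGraph.edge (Sum.inl x) (Sum.inr y)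

/-- `Built p k V T A`: the tree `T` on the vertex type `V`, with its marked set `A = A(T)`, is the
last term `T_k` of a sequence `T_0, …, T_k` that starts at `T_0 = K_{1,p}`, `A(T_0) = L(K_{1,p})`,
and in which each step is one of the four operations. -/
inductive Built (p : ℕ) : ℕ → (V : Type) → SimpleGraph V → Set V → Prop
  | base : Built p 0 (Unit ⊕ Fin p) (starK p) (leafSet (starK p))
  | op₁ {k : ℕ} {V : Type} {T : SimpleGraph V} {A : Set V} (h : Built p k V T A)
      (y : V) (hy : y ∈ A) :
      Built p (k + 1) ((Unit ⊕ Fin (p - 1)) ⊕ V) (joinEdge (starK (p - 1)) T (Sum.inl ()) y)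
        (Sum.inl '' leafSet (starK (p - 1)) ∪ Sum.inr '' A)
  | op₂ {k : ℕ} {V : Type} {T : SimpleGraph V} {A : Set V} (h : Built p k V T A)
      (y : V) (hy : y ∉ A) :
      Built p (k + 1) ((Unit ⊕ Fin p) ⊕ V) (joinEdge (starK p) T (Sum.inl ()) y)
        (Sum.inl '' leafSet (starK p) ∪ Sum.inr '' A)
  | op₃ {k : ℕ} {V : Type} {T : SimpleGraph V} {A : Set V} (h : Built p k V T A)
      (y : V) (hy : y ∈ A)
      (hPN : min (p + 1) ((T.neighborSet y ∩ A).ncard + 2) ≤ (privateNbrs p T A y).ncard)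
      (D : Set (Fin 3 ⊕ (Fin 2 × Fin (p - 1)))) (hD : IsUniqueGammaSet p (treeF (p - 1)) D) :
      Built p (k + 1) ((Fin 3 ⊕ (Fin 2 × Fin (p - 1))) ⊕ V)
        (joinEdge (treeF (p - 1)) T (Sum.inl 1) y) (Sum.inl '' D ∪ Sum.inr '' A)
  | op₄ {k : ℕ} {V : Type} {T : SimpleGraph V} {A : Set V} (h : Built p k V T A)
      (t : ℕ) (ht : p ≤ t) (y : V)
      (D : Set (((Unit ⊕ Fin t) ⊕ (Fin t × Fin 1)) ⊕ (Fin t × Fin (p - 1))))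
      (hD : IsUniqueGammaSet p (treeF₂ t (p - 1)) D) :
      Built p (k + 1) ((((Unit ⊕ Fin t) ⊕ (Fin t × Fin 1)) ⊕ (Fin t × Fin (p - 1))) ⊕ V)
        (joinEdge (treeF₂ t (p - 1)) T (Sum.inl (Sum.inl (Sum.inl ()))) y)
        (Sum.inl '' D ∪ Sum.inr '' A)

/-- `T` is, up to isomorphism, the last term of a construction sequence with at least one
operation, and `A` is the marked set `A(T)` that this sequence produces. -/
def InFamilyWith {V : Type u} (p : ℕ) (T : SimpleGraph V) (A : Set V) : Prop :=
  ∃ k : ℕ, 1 ≤ k ∧ ∃ (W : Type) (G : SimpleGraph W) (A' : Set W),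
    Built p k W G A' ∧ ∃ e : T ≃g G, e '' A = A'

/-- `T` belongs to the family `𝒯_p`. -/
def InFamily {V : Type u} (p : ℕ) (T : SimpleGraph V) : Prop :=
  ∃ A : Set V, InFamilyWith p T A

end PReinforcement

namespace PReinforcement

/-! ### Parents in a rooted tree -/

section Tree

variable {V : Type*} {T : SimpleGraph V}

/-! Let the deficiency of a vertex set X be the total shortfall of its outside vertices, the sum of
max(0, p − |N(v) ∩ X|) over v ∉ X. Edges that make X dominating must cover this shortfall, and if
|X| ≥ p exactly that many new edges suffice. So, when γ_p > p, the number r_p measures how small the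
deficiency of a set with fewer than γ_p elements can be.

Erasing x from a γ_p-set D costs at most max(0, p − |N(x) ∩ D|) + |PN_p(x)|. In a tree a deepest x
in D has at most one private neighbour, its parent, so r_p ≤ p + 1. If r_p = p + 1, every erasure
costs at least p + 1, which is the condition `IsTight`.

Conversely, `le_deficiency_of_isTight` shows that replacing a tight set D of a tree by X leaves
deficiency at least (p + 1)s + 2 − 2(s + q), where s = |D \ X| ≥ 1 and q = |X \ D|; the loss comes
from two edge counts in forests. For p ≥ 3 this is positive when |X| ≤ |D| and at least p + 1 when
|X| < |D|. Hence a tight set is the unique γ_p-set, and r_p = p + 1 holds exactly when some tight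
set has more than p elements.

It remains to identify trees with a tight set with those built by the operations. Every operation
preserves tightness (`Built.isTight`). In the other direction (`IsTight.constructible_of_smaller`),
root the tree at a leaf and look at the lower end of a longest path from the root. Either the tree
is K_{1,p}, or some branch there is a star, an F_{p-1} or an F_{t,p-1} whose removal undoes one
operation and leaves a smaller tree with a tight set. The bound |D| > p corresponds to using at
least one operation. -/

theorem dist_adj_cases (hT : T.IsTree) (r : V) {u v : V} (h : T.Adj u v) :
    T.dist r u = T.dist r v + 1 ∨ T.dist r v = T.dist r u + 1 :=
  hT.dist_eq_dist_add_one_of_adj r h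

theorem parent_unique (hT : T.IsTree) (r : V) {u v w : V} (hv : T.Adj u v) (hw : T.Adj u w)
    (dv : T.dist r u = T.dist r v + 1) (dw : T.dist r u = T.dist r w + 1) : v = w := by
  obtain ⟨p, hp⟩ := hT.connected.exists_walk_length_eq_dist r v
  obtain ⟨q, hq⟩ := hT.connected.exists_walk_length_eq_dist r w
  have h1 : (p.concat hv.symm).IsPath := SimpleGraph.Walk.isPath_of_length_eq_dist _ (by simp; omega)
  have h2 : (q.concat hw.symm).IsPath := SimpleGraph.Walk.isPath_of_length_eq_dist _ (by simp; omega)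
  have := congrArg SimpleGraph.Walk.penultimate (hT.existsUnique_path r u |>.unique h1 h2)
  simpa using this

theorem exists_parent (hT : T.IsTree) {r u : V} (h : u ≠ r) :
    ∃ v, T.Adj u v ∧ T.dist r u = T.dist r v + 1 := by
  obtain ⟨p, hp⟩ := hT.connected.exists_walk_length_eq_dist u r
  cases p with
  | nil => exact absurd rfl h
  | @cons _ v _ hv q =>
    refine ⟨v, hv, ?_⟩
    rcases dist_adj_cases hT r hv with h' | h'
    · exact h'
    · have := SimpleGraph.dist_le q
      rw [SimpleGraph.dist_comm (u := v)] at this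
      rw [SimpleGraph.dist_comm] at hp
      simp at hp
      omega

end Tree

/-! ### Edge counts between vertex sets of a tree -/

section Counting

open Classical

variable {V : Type*} (G : SimpleGraph V)

/-- The number of neighbours of `v` in the finite set `A`. -/
noncomputable def nbCount (v : V) (A : Finset V) : ℕ := (A.filter (G.Adj v)).card

/-- The number of adjacent pairs in `A × B`. -/
noncomputable def pairCount (A B : Finset V) : ℕ := ∑ u ∈ A, nbCount G u B

theorem nbCount_eq_sum (v : V) (A : Finset V) :
    nbCount G v A = ∑ w ∈ A, if G.Adj v w then 1 else 0 := by
  simp [nbCount]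

theorem pairCount_comm (A B : Finset V) : pairCount G A B = pairCount G B A := by
  simp only [pairCount, nbCount_eq_sum]
  rw [Finset.sum_comm]
  simp only [G.adj_comm]

theorem nbCount_union (v : V) {A B : Finset V} (h : Disjoint A B) :
    nbCount G v (A ∪ B) = nbCount G v A + nbCount G v B := by
  simp only [nbCount_eq_sum, Finset.sum_union h]

theorem pairCount_union_left {A B : Finset V} (h : Disjoint A B) (C : Finset V) :
    pairCount G (A ∪ B) C = pairCount G A C + pairCount G B C :=
  Finset.sum_union h

theorem pairCount_union_right (C : Finset V) {A B : Finset V} (h : Disjoint A B) :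
    pairCount G C (A ∪ B) = pairCount G C A + pairCount G C B := by
  simp only [pairCount_comm G C, pairCount_union_left G h]

theorem nbCount_mono (v : V) {A B : Finset V} (h : A ⊆ B) : nbCount G v A ≤ nbCount G v B :=
  Finset.card_le_card (Finset.filter_subset_filter _ h)

variable {G}

/-- A nonempty set of vertices of a tree spans fewer edges than it has elements. -/
theorem pairCount_self_le (hT : G.IsTree) (U : Finset V) (hU : U.Nonempty) :
    pairCount G U U + 2 ≤ 2 * U.card := by
  obtain ⟨r⟩ := hT.connected.nonempty
  induction U using Finset.induction_on_max_value (G.dist r) with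
  | empty => simp at hU
  | insert a s ha hmax ih =>
    have hd : Disjoint {a} s := by simpa using ha
    have h0 : nbCount G a {a} = 0 := by simp [nbCount, Finset.filter_singleton]
    -- The vertex `a` is deepest, so any neighbour of it in `s` is its parent.
    have h1 : nbCount G a s ≤ 1 := by
      refine Finset.card_le_one.2 fun u hu v hv => ?_
      simp only [Finset.mem_filter] at hu hv
      have hu' := hmax u hu.1
      have hv' := hmax v hv.1
      refine parent_unique hT r hu.2 hv.2 ?_ ?_
      · rcases dist_adj_cases hT r hu.2 with h | h <;> omega
      · rcases dist_adj_cases hT r hv.2 with h | h <;> omega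
    rw [Finset.insert_eq, pairCount_union_left G hd, pairCount_union_right G _ hd,
      pairCount_union_right G _ hd, Finset.card_union_of_disjoint hd, pairCount_comm G s {a}]
    have e1 : pairCount G {a} {a} = 0 := by simp [pairCount, h0]
    have e2 : pairCount G {a} s ≤ 1 := by simpa [pairCount] using h1
    rcases s.eq_empty_or_nonempty with rfl | hs
    · simp [pairCount, nbCount]
    · have := ih hs
      simp only [Finset.card_singleton]
      omega

/-- The union of the three classes spans a forest; the edges inside the classes are simply dropped.
-/
theorem pairCount_tripartite_le (hT : G.IsTree) {S R Q : Finset V} (hSR : Disjoint S R)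
    (hSQ : Disjoint S Q) (hRQ : Disjoint R Q) (hS : S.Nonempty) :
    pairCount G S R + pairCount G Q S + pairCount G Q R + 1 ≤ S.card + R.card + Q.card := by
  have hd : Disjoint (S ∪ R) Q := by simp [hSQ, hRQ]
  have := pairCount_self_le hT (S ∪ R ∪ Q) (by simp [hS])
  simp only [pairCount_union_left G hd, pairCount_union_right G _ hd, pairCount_union_left G hSR,
    pairCount_union_right G _ hSR, Finset.card_union_of_disjoint hd,
    Finset.card_union_of_disjoint hSR] at this
  rw [pairCount_comm G R S, pairCount_comm G S Q, pairCount_comm G R Q] at this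
  omega

end Counting

/-- The number of neighbours of `v` in `D`. -/
noncomputable def domCount {V : Type*} (G : SimpleGraph V) (D : Set V) (v : V) : ℕ :=
  (G.neighborSet v ∩ D).ncard

/-- `D` is `p`-dominating, and the removal of any single vertex from `D` costs at least `p + 1`
new edges. -/
structure IsTight {V : Type*} (p : ℕ) (G : SimpleGraph V) (D : Set V) : Prop where
  dom : ∀ v, v ∉ D → p ≤ domCount G D v
  tight : ∀ x, x ∈ D → min (p + 1) (domCount G D x + 1) ≤ (privateNbrs p G D x).ncard

/-! ### Deficiency, tight sets and the reinforcement number -/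

section Deficiency

open Classical

variable {V : Type*} (p : ℕ) (G : SimpleGraph V)

theorem domCount_coe (D : Finset V) (v : V) : domCount G (D : Set V) v = nbCount G v D := by
  rw [domCount, nbCount, ← Set.ncard_coe_finset]
  congr 1
  ext w
  simp [and_comm]

theorem sdiff_nonempty_of_card_le {D X : Finset V} (hne : X ≠ D) (hc : X.card ≤ D.card) :
    (D \ X).Nonempty := by
  rw [Finset.sdiff_nonempty]
  intro h
  exact hne (Finset.eq_of_subset_of_card_le h hc).symm

theorem card_sdiff_add (D X : Finset V) : (D \ X).card + X.card = (X \ D).card + D.card := by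
  have h1 := Finset.card_sdiff_add_card_inter D X
  have h2 := Finset.card_sdiff_add_card_inter X D
  rw [Finset.inter_comm] at h2
  omega

variable {p G}

theorem domNum_le {D : Set V} (h : IsPDominating p G D) : domNum p G ≤ D.ncard :=
  Nat.sInf_le ⟨D, h, rfl⟩

variable [Fintype V] (p G)

/-- The number of edges that are missing for `X` to be `p`-dominating. -/
noncomputable def deficiency (X : Finset V) : ℕ := ∑ v ∈ Finset.univ \ X, (p - nbCount G v X)

theorem ncard_privateNbrs (D : Finset V) (x : V) :
    (privateNbrs p G (D : Set V) x).ncard =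
      nbCount G x (Finset.univ.filter fun y => y ∉ D ∧ nbCount G y D = p) := by
  rw [nbCount, ← Set.ncard_coe_finset]
  congr 1
  ext y
  have := domCount_coe G D y
  simp only [domCount] at this
  simp [privateNbrs, this]
  tauto

variable {p G}

theorem deficiency_eq_zero {X : Finset V} (h : IsPDominating p G (X : Set V)) :
    deficiency p G X = 0 := by
  refine Finset.sum_eq_zero fun v hv => ?_
  have := h v (by simpa using hv)
  rw [← domCount, domCount_coe] at this
  omega

/-- Exchange estimate in a tree: replacing a tight set `D` by `X` leaves a large deficiency. -/
theorem le_deficiency_of_isTight (hT : G.IsTree) {D X : Finset V} (hD : IsTight p G (D : Set V))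
    (hS : (D \ X).Nonempty) :
    (p + 1) * (D \ X).card + 2 ≤ deficiency p G X + 2 * ((D \ X).card + (X \ D).card) := by
  set S := D \ X with hSdef
  set R := X \ D with hRdef
  -- `P` collects the private vertices of all elements of `D`; `Q` those that lose a neighbour in
  -- `S` but gain one in `R`, so that their loss may be compensated.
  set P := Finset.univ.filter fun y => y ∉ D ∧ nbCount G y D = p with hP
  set Q := (P \ R).filter fun y => 1 ≤ nbCount G y S ∧ 1 ≤ nbCount G y R with hQ
  have hSR : Disjoint S R := by
    rw [Finset.disjoint_left]; intro a; simp [hSdef, hRdef]; tauto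
  have hSP : Disjoint S (P \ R) := by
    rw [Finset.disjoint_left]; intro a; simp [hSdef, hP]; tauto
  have hSQ : Disjoint S Q := hSP.mono_right (Finset.filter_subset _ _)
  have hRQ : Disjoint R Q := by
    rw [Finset.disjoint_left]; intro a; simp [hQ]; tauto
  -- Tightness in additive form: the shortfall of an erased `x` plus its number of private
  -- neighbours is at least `p + 1`.
  have h1 : (p + 1) * S.card ≤ ∑ x ∈ S, ((p - nbCount G x D) + nbCount G x P) := by
    rw [mul_comm, ← smul_eq_mul]
    refine Finset.card_nsmul_le_sum _ _ _ fun x hx => ?_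
    have := hD.tight x (by simpa using (Finset.mem_sdiff.1 hx).1)
    rw [domCount_coe, ncard_privateNbrs] at this
    simp only [← hP] at this
    omega
  have h2 : ∑ x ∈ S, (p - nbCount G x D) ≤ ∑ x ∈ S, (p - nbCount G x X) + pairCount G S R := by
    rw [pairCount, ← Finset.sum_add_distrib]
    refine Finset.sum_le_sum fun x _ => ?_
    have : nbCount G x X ≤ nbCount G x D + nbCount G x R := by
      rw [← nbCount_union _ _ (by rw [hRdef]; exact Finset.disjoint_sdiff)]
      exact nbCount_mono _ _ (by rw [hRdef]; simp)
    omega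
  have h3 : ∑ x ∈ S, nbCount G x P ≤ pairCount G S R + ∑ y ∈ P \ R, nbCount G y S := by
    change _ ≤ _ + pairCount G (P \ R) S
    rw [pairCount_comm G (P \ R), ← pairCount_union_right _ _ Finset.disjoint_sdiff]
    exact Finset.sum_le_sum fun x _ => nbCount_mono _ _ (by simp)
  -- Outside `Q`, a vertex has no neighbour in `S` or none in `R`, so its shortfall is at least its
  -- number of neighbours in `S`. A vertex of `Q` is charged to its edges instead, and one edge to
  -- `R` pays for the extra `Q.card`.
  have h4 : ∑ y ∈ P \ R, nbCount G y S + Q.card ≤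
      ∑ y ∈ P \ R, (p - nbCount G y X) + (pairCount G Q S + pairCount G Q R) := by
    rw [pairCount, pairCount, ← Finset.sum_add_distrib, hQ, Finset.card_filter, Finset.sum_filter,
      ← Finset.sum_add_distrib, ← Finset.sum_add_distrib]
    refine Finset.sum_le_sum fun y hy => ?_
    have hyD : nbCount G y D = p := by simp [hP] at hy; exact hy.1.2
    have e1 : nbCount G y X = nbCount G y (D ∩ X) + nbCount G y R := by
      rw [← nbCount_union]
      · congr 1; ext a; simp [hRdef]; tauto
      · rw [Finset.disjoint_left]; intro a; simp [hRdef]; tauto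
    have e2 : nbCount G y D = nbCount G y (D ∩ X) + nbCount G y S := by
      rw [← nbCount_union]
      · congr 1; ext a; simp [hSdef]; tauto
      · rw [Finset.disjoint_left]; intro a; simp [hSdef]; tauto
    split_ifs <;> omega
  have h5 : ∑ x ∈ S, (p - nbCount G x X) + ∑ y ∈ P \ R, (p - nbCount G y X) ≤
      deficiency p G X := by
    rw [← Finset.sum_union hSP]
    refine Finset.sum_le_sum_of_subset fun a => ?_
    simp [hSdef, hRdef, hP]; tauto
  -- The edges between `S` and `R` are lost twice, in `h2` and in `h3`. Hence the forest bound is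
  -- used twice: with `Q`, whose size cancels against `h4`, and without it.
  have h6 := pairCount_tripartite_le hT hSR hSQ hRQ hS
  have h7 := pairCount_tripartite_le hT (Q := ∅) hSR (by simp) (by simp) hS
  simp only [Finset.card_empty, add_zero] at h7
  rw [Finset.sum_add_distrib] at h1
  omega

theorem deficiency_pos (hp : 3 ≤ p) (hT : G.IsTree) {D X : Finset V}
    (hD : IsTight p G (D : Set V)) (hne : X ≠ D) (hc : X.card ≤ D.card) :
    0 < deficiency p G X := by
  have h := le_deficiency_of_isTight hT hD (sdiff_nonempty_of_card_le hne hc)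
  have := card_sdiff_add D X
  have : 4 * (D \ X).card ≤ (p + 1) * (D \ X).card := Nat.mul_le_mul_right _ (by omega)
  omega

theorem succ_le_deficiency (hp : 3 ≤ p) (hT : G.IsTree) {D X : Finset V}
    (hD : IsTight p G (D : Set V)) (hc : X.card < D.card) : p + 1 ≤ deficiency p G X := by
  have h0 := sdiff_nonempty_of_card_le (by rintro rfl; simp at hc) hc.le
  have h := le_deficiency_of_isTight hT hD h0
  have := card_sdiff_add D X
  have h1 := h0.card_pos
  obtain ⟨q, rfl⟩ := Nat.exists_eq_add_of_le hp
  obtain ⟨s, hs⟩ := Nat.exists_eq_add_of_le h1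
  rw [hs] at h this
  nlinarith [Nat.zero_le (q * s)]

/-- A tight set of a tree is the unique `γ_p`-set. -/
theorem IsTight.isUniqueGammaSet (hp : 3 ≤ p) (hT : G.IsTree) {D : Set V} (hD : IsTight p G D) :
    IsUniqueGammaSet p G D := by
  obtain ⟨D, rfl⟩ : ∃ D' : Finset V, (D' : Set V) = D := ⟨D.toFinset, by simp⟩
  have hmem : (D : Set V).ncard ∈ {n | ∃ S : Set V, IsPDominating p G S ∧ S.ncard = n} :=
    ⟨D, hD.dom, rfl⟩
  have key : ∀ S : Set V, IsPDominating p G S → S.ncard ≤ (D : Set V).ncard → S = D := by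
    intro S hS hc
    obtain ⟨S, rfl⟩ : ∃ S' : Finset V, (S' : Set V) = S := ⟨S.toFinset, by simp⟩
    by_contra hne
    rw [Finset.coe_inj] at hne
    simp only [Set.ncard_coe_finset] at hc
    have := deficiency_pos hp hT hD hne hc
    rw [deficiency_eq_zero hS] at this
    omega
  intro S
  constructor
  · rintro ⟨h1, h2⟩
    exact key S h1 (h2.trans_le (Nat.sInf_le hmem))
  · rintro rfl
    refine ⟨hD.dom, le_antisymm ?_ (Nat.sInf_le hmem)⟩
    obtain ⟨S, h1, h2⟩ := Nat.sInf_mem ⟨_, hmem⟩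
    rw [domNum, ← h2]
    by_contra hlt
    rw [key S h1 (by omega)] at hlt
    omega

theorem exists_gammaSet (p : ℕ) (G : SimpleGraph V) : ∃ D : Finset V, IsGammaSet p G (D : Set V) := by
  obtain ⟨S, h1, h2⟩ := Nat.sInf_mem (s := {n | ∃ S : Set V, IsPDominating p G S ∧ S.ncard = n})
    ⟨_, Set.univ, fun v hv => absurd trivial hv, rfl⟩
  exact ⟨S.toFinset, by simpa using h1, by rw [domNum, ← h2]; simp⟩

/-- A set that is `p`-dominating after adding the edges `B` has deficiency at most `|B|`. -/
theorem deficiency_le_ncard {B : Set (Sym2 V)} {X : Finset V}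
    (h : IsPDominating p (G ⊔ SimpleGraph.fromEdgeSet B) (X : Set V)) :
    deficiency p G X ≤ B.ncard := by
  set N : V → Finset V := fun v => X.filter fun w => s(v, w) ∈ B with hN
  have h1 : deficiency p G X ≤ ∑ v ∈ Finset.univ \ X, (N v).card := by
    refine Finset.sum_le_sum fun v hv => ?_
    have h2 := h v (by simpa using hv)
    rw [← domCount, domCount_coe] at h2
    have : nbCount (G ⊔ SimpleGraph.fromEdgeSet B) v X ≤ nbCount G v X + (N v).card := by
      rw [nbCount, nbCount]
      refine le_trans (Finset.card_le_card ?_) (Finset.card_union_le _ _)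
      intro w
      simp [hN]
      tauto
    omega
  refine h1.trans ?_
  rw [← Finset.card_sigma, ← Set.ncard_coe_finset]
  -- An added edge that helps has exactly one end in `X`, so it is counted for one vertex only.
  refine Set.ncard_le_ncard_of_injOn (fun q => s(q.1, q.2)) ?_ ?_ B.toFinite
  · rintro ⟨v, w⟩ hq
    simp [hN] at hq
    exact hq.2.2
  · rintro ⟨v, w⟩ hq ⟨v', w'⟩ hq' he
    simp [hN] at hq hq' he
    rcases he with ⟨rfl, rfl⟩ | ⟨rfl, rfl⟩
    · rfl
    · exact absurd hq'.2.1 hq.1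

/-- The missing edges of `X` can be added. -/
theorem exists_edges_of_deficiency {X : Finset V} (hX : p ≤ X.card) :
    ∃ B : Set (Sym2 V), B ⊆ Gᶜ.edgeSet ∧ B.ncard ≤ deficiency p G X ∧
      IsPDominating p (G ⊔ SimpleGraph.fromEdgeSet B) (X : Set V) := by
  have hF : ∀ v, ∃ F : Finset V, F ⊆ X.filter (fun w => ¬ G.Adj v w) ∧
      F.card = p - nbCount G v X := by
    intro v
    -- Because `p ≤ X.card`, there are enough non-neighbours of `v` in `X` to fill its shortfall.
    refine Finset.exists_subset_card_eq ?_
    have : nbCount G v X + (X.filter fun w => ¬ G.Adj v w).card = X.card := by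
      rw [nbCount]
      convert Finset.card_filter_add_card_filter_not (s := X) (fun w => G.Adj v w)
    omega
  choose F hF1 hF2 using hF
  have hFm : ∀ v w, w ∈ F v → w ∈ X ∧ ¬ G.Adj v w := fun v w hw => by simpa using hF1 v hw
  set I : Finset (Σ _ : V, V) := (Finset.univ \ X).sigma F with hI
  refine ⟨((I.image fun q => s(q.1, q.2) : Finset (Sym2 V)) : Set (Sym2 V)), ?_, ?_, ?_⟩
  · intro e he
    simp only [Finset.coe_image, Set.mem_image] at he
    obtain ⟨⟨v, w⟩, hq, rfl⟩ := he
    simp [hI] at hq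
    have := hFm v w hq.2
    simp only [SimpleGraph.mem_edgeSet, SimpleGraph.compl_adj]
    refine ⟨?_, this.2⟩
    rintro rfl
    exact hq.1 this.1
  · rw [Set.ncard_coe_finset]
    refine Finset.card_image_le.trans ?_
    rw [hI, Finset.card_sigma, deficiency]
    exact (Finset.sum_congr rfl fun v _ => hF2 v).le
  · intro v hv
    rw [← domCount, domCount_coe]
    have hv' : v ∉ X := by simpa using hv
    have : X.filter (G.Adj v) ∪ F v ⊆ X.filter ((G ⊔ SimpleGraph.fromEdgeSet
        ((I.image fun q => s(q.1, q.2) : Finset (Sym2 V)) : Set (Sym2 V))).Adj v) := by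
      intro w hw
      rw [Finset.mem_union, Finset.mem_filter] at hw
      rw [Finset.mem_filter, SimpleGraph.sup_adj, SimpleGraph.fromEdgeSet_adj]
      rcases hw with hw | hw
      · exact ⟨hw.1, Or.inl hw.2⟩
      · refine ⟨(hFm v w hw).1, Or.inr ⟨?_, ?_⟩⟩
        · simp only [Finset.coe_image, Set.mem_image]
          exact ⟨⟨v, w⟩, by simp [hI, hv', hw], rfl⟩
        · rintro rfl
          exact hv' (hFm v v hw).1
    have h2 : (X.filter (G.Adj v) ∪ F v).card ≤ nbCount (G ⊔ SimpleGraph.fromEdgeSet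
        ((I.image fun q => s(q.1, q.2) : Finset (Sym2 V)) : Set (Sym2 V))) v X := by
      rw [nbCount]
      convert Finset.card_le_card this
    rw [Finset.card_union_of_disjoint, hF2] at h2
    · rw [nbCount] at h2
      omega
    · rw [Finset.disjoint_left]
      intro w hw hw'
      exact (hFm v w hw').2 (Finset.mem_filter.1 hw).2

theorem reinfNum_le_deficiency {X : Finset V} (hX : p ≤ X.card) (hc : X.card < domNum p G) :
    reinfNum p G ≤ deficiency p G X := by
  obtain ⟨B, h1, h2, h3⟩ := exists_edges_of_deficiency (G := G) hX
  rw [reinfNum, if_neg (by omega)]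
  refine le_trans (Nat.sInf_le ⟨B, h1, ?_, rfl⟩) h2
  have := domNum_le h3
  rw [Set.ncard_coe_finset] at this
  omega

theorem le_reinfNum {k : ℕ} (hg : p < domNum p G)
    (h : ∀ X : Finset V, X.card < domNum p G → k ≤ deficiency p G X) : k ≤ reinfNum p G := by
  rw [reinfNum, if_neg (by omega)]
  obtain ⟨D, hD, hDc⟩ := exists_gammaSet p G
  rw [Set.ncard_coe_finset] at hDc
  -- Any `p` vertices can be made dominating by new edges, so the infimum is over a nonempty set and
  -- is not the default value `0`.
  obtain ⟨X, hXD, hXc⟩ := Finset.exists_subset_card_eq (s := D) (n := p) (by omega)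
  obtain ⟨B, h1, h2, h3⟩ := exists_edges_of_deficiency (G := G) hXc.ge
  have hne : {n | ∃ B : Set (Sym2 V), B ⊆ Gᶜ.edgeSet ∧
    domNum p (G ⊔ SimpleGraph.fromEdgeSet B) < domNum p G ∧ B.ncard = n}.Nonempty := by
    refine ⟨_, B, h1, ?_, rfl⟩
    have := domNum_le h3
    rw [Set.ncard_coe_finset] at this
    omega
  obtain ⟨B, -, h2, h3⟩ := Nat.sInf_mem hne
  rw [← h3]
  obtain ⟨X, hX, hXc⟩ := exists_gammaSet p (G ⊔ SimpleGraph.fromEdgeSet B)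
  rw [Set.ncard_coe_finset] at hXc
  exact (h X (by omega)).trans (deficiency_le_ncard hX)

/-- The first term is the shortfall of `x` itself; besides it, only a vertex that had exactly `p`
neighbours in `D`, one of them `x`, falls short, and by one. -/
theorem deficiency_erase_le {D : Finset V} (hD : IsPDominating p G (D : Set V)) {x : V}
    (hx : x ∈ D) : deficiency p G (D.erase x) ≤
      (p - domCount G (D : Set V) x) + (privateNbrs p G (D : Set V) x).ncard := by
  rw [domCount_coe, ncard_privateNbrs, deficiency]
  have e : Finset.univ \ D.erase x = insert x (Finset.univ \ D) := by
    ext a; simp; tauto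
  have hsplit : ∀ v, nbCount G v D = nbCount G v (D.erase x) + if G.Adj v x then 1 else 0 := by
    intro v
    rw [nbCount_eq_sum, nbCount_eq_sum, Finset.sum_erase_add _ _ hx]
  rw [e, Finset.sum_insert (by simp [hx])]
  refine Nat.add_le_add ?_ ?_
  · have := hsplit x
    simp only [SimpleGraph.irrefl, if_false] at this
    omega
  · rw [nbCount_eq_sum, Finset.sum_filter]
    refine (Finset.sum_le_sum fun v hv => ?_).trans
      (Finset.sum_le_sum_of_subset (Finset.subset_univ (Finset.univ \ D)))
    have hv' : v ∉ D := by simpa using hv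
    have h1 := hD v (by simpa using hv')
    rw [← domCount, domCount_coe] at h1
    have h2 := hsplit v
    rw [G.adj_comm] at h2
    simp only [hv', not_false_eq_true, true_and]
    split_ifs at h2 ⊢ <;> omega

/-- A deepest vertex of a `p`-dominating set of a tree has at most one private neighbour. -/
theorem exists_ncard_privateNbrs_le_one (hp : 2 ≤ p) (hT : G.IsTree) {D : Finset V}
    (hne : D.Nonempty) : ∃ x ∈ D, (privateNbrs p G (D : Set V) x).ncard ≤ 1 := by
  obtain ⟨r⟩ := hT.connected.nonempty
  obtain ⟨x, hx, hmax⟩ := D.exists_max_image (G.dist r) hne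
  refine ⟨x, hx, ?_⟩
  have key : ∀ y ∈ privateNbrs p G (D : Set V) x, G.dist r x = G.dist r y + 1 := by
    rintro y ⟨-, hadj, hc⟩
    rcases dist_adj_cases hT r hadj with h | h
    · exact h
    · exfalso
      -- A private child `y` of `x` would have a second neighbour in `D`, since `p ≥ 2`; not being
      -- the parent of `y`, it would lie deeper than `x`.
      obtain ⟨z, hz, hzx⟩ := Set.exists_ne_of_one_lt_ncard (s := G.neighborSet y ∩ D)
        (by omega) x
      have hz1 : G.Adj y z := hz.1
      refine hzx (parent_unique hT r hz1 hadj.symm ?_ h)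
      have := hmax z hz.2
      rcases dist_adj_cases hT r hz1 with h' | h' <;> omega
  rw [Set.ncard_le_one_iff]
  intro a b ha hb
  exact parent_unique hT r ha.2.1 hb.2.1 (key a ha) (key b hb)

theorem reinfNum_le_succ (hp : 2 ≤ p) (hT : G.IsTree) : reinfNum p G ≤ p + 1 := by
  by_cases hg : domNum p G ≤ p
  · simp [reinfNum, hg]
  obtain ⟨D, hD, hDc⟩ := exists_gammaSet p G
  rw [Set.ncard_coe_finset] at hDc
  obtain ⟨x, hx, h1⟩ := exists_ncard_privateNbrs_le_one hp hT (D := D)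
    (Finset.card_pos.1 (by omega))
  have h2 := deficiency_erase_le hD hx
  have h3 := Finset.card_erase_of_mem hx
  have h4 := reinfNum_le_deficiency (p := p) (G := G) (X := D.erase x) (by omega) (by omega)
  omega

/-- If erasing some element of a `γ_p`-set cost at most `p` edges, that would bound `r_p` by `p`;
tightness is precisely the denial of this for each element. -/
theorem exists_isTight_of_reinfNum_eq (h : reinfNum p G = p + 1) :
    p < domNum p G ∧ ∃ D : Set V, IsTight p G D ∧ D.ncard = domNum p G := by
  have hg : p < domNum p G := by
    by_contra hg
    simp [reinfNum, not_lt.1 hg] at h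
  obtain ⟨D, hD, hDc⟩ := exists_gammaSet p G
  refine ⟨hg, D, ⟨hD, fun x hx => ?_⟩, hDc⟩
  rw [Set.ncard_coe_finset] at hDc
  have hx' : x ∈ D := by simpa using hx
  have h2 := deficiency_erase_le hD hx'
  have h3 := Finset.card_erase_of_mem hx'
  have h4 := reinfNum_le_deficiency (p := p) (G := G) (X := D.erase x) (by omega) (by omega)
  omega

theorem IsTight.reinfNum_eq (hp : 3 ≤ p) (hT : G.IsTree) {D : Set V} (hD : IsTight p G D)
    (hc : p < D.ncard) : reinfNum p G = p + 1 := by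
  refine le_antisymm (reinfNum_le_succ (by omega) hT) ?_
  have hu := ((hD.isUniqueGammaSet hp hT D).2 rfl).2
  obtain ⟨D, rfl⟩ : ∃ D' : Finset V, (D' : Set V) = D := ⟨D.toFinset, by simp⟩
  refine le_reinfNum (by omega) fun X hX => succ_le_deficiency hp hT hD ?_
  rw [Set.ncard_coe_finset] at hu
  omega

end Deficiency

/-! ### Subgraphs attached by a single edge -/

section Hanging

variable {V W : Type*} {G : SimpleGraph V} {H : SimpleGraph W}

/-- The image of the embedding `ψ` is joined to the rest of `G` by the single edge from `ψ y`
to `c`. -/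
structure HangsAt (ψ : H ↪g G) (y : W) (c : V) : Prop where
  adj : G.Adj (ψ y) c
  not_mem : c ∉ Set.range ψ
  only : ∀ v w, G.Adj (ψ v) w → w ∈ Set.range ψ ∨ (v = y ∧ w = c)

variable {ψ : H ↪g G} {y : W} {c : V} {D : Set V} {p : ℕ}

theorem HangsAt.domCount_eq (h : HangsAt ψ y c) {v : W} (hv : c ∈ D → v ≠ y) :
    domCount G D (ψ v) = domCount H (ψ ⁻¹' D) v := by
  rw [domCount, domCount, ← Set.ncard_image_of_injective _ ψ.injective]
  congr 1
  ext w
  constructor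
  · rintro ⟨hw, hwD⟩
    rcases h.only v w hw with ⟨w, rfl⟩ | ⟨rfl, rfl⟩
    · exact ⟨w, ⟨ψ.map_adj_iff.1 hw, hwD⟩, rfl⟩
    · exact absurd rfl (hv hwD)
  · rintro ⟨w, ⟨hw, hwD⟩, rfl⟩
    exact ⟨ψ.map_adj_iff.2 hw, hwD⟩

theorem HangsAt.domCount_succ [Finite V] (h : HangsAt ψ y c) (hc : c ∈ D) :
    domCount G D (ψ y) = domCount H (ψ ⁻¹' D) y + 1 := by
  rw [domCount, domCount, ← Set.ncard_image_of_injective _ ψ.injective,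
    ← Set.ncard_insert_of_notMem (a := c) _ (Set.toFinite _)]
  · congr 1
    ext w
    constructor
    · rintro ⟨hw, hwD⟩
      rcases h.only y w hw with ⟨w, rfl⟩ | ⟨-, rfl⟩
      · exact Or.inr ⟨w, ⟨ψ.map_adj_iff.1 hw, hwD⟩, rfl⟩
      · exact Or.inl rfl
    · rintro (rfl | ⟨w, ⟨hw, hwD⟩, rfl⟩)
      · exact ⟨h.adj, hc⟩
      · exact ⟨ψ.map_adj_iff.2 hw, hwD⟩
  · rintro ⟨w, -, rfl⟩
    exact h.not_mem ⟨w, rfl⟩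

/-- Only `ψ y` can gain a marked neighbour from the connecting edge, and under `hc` it is then
itself marked; so counts at unmarked vertices, which decide privacy, do not change. -/
theorem HangsAt.mem_privateNbrs_iff (h : HangsAt ψ y c) (hc : c ∈ D → ψ y ∈ D) {v u : W} :
    ψ u ∈ privateNbrs p G D (ψ v) ↔ u ∈ privateNbrs p H (ψ ⁻¹' D) v := by
  have key : ψ u ∉ D → domCount G D (ψ u) = domCount H (ψ ⁻¹' D) u := by
    intro hu
    refine h.domCount_eq fun hcD => ?_
    rintro rfl
    exact hu (hc hcD)
  constructor
  · rintro ⟨h1, h2, h3⟩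
    exact ⟨h1, ψ.map_adj_iff.1 h2, (key h1).symm.trans h3⟩
  · rintro ⟨h1, h2, h3⟩
    exact ⟨h1, ψ.map_adj_iff.2 h2, (key h1).trans h3⟩

theorem HangsAt.ncard_privateNbrs_le [Finite V] (h : HangsAt ψ y c) (hc : c ∈ D → ψ y ∈ D)
    (v : W) : (privateNbrs p H (ψ ⁻¹' D) v).ncard ≤ (privateNbrs p G D (ψ v)).ncard := by
  rw [← Set.ncard_image_of_injective _ ψ.injective]
  refine Set.ncard_le_ncard ?_
  rintro _ ⟨u, hu, rfl⟩
  exact (h.mem_privateNbrs_iff hc).2 hu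

theorem HangsAt.ncard_privateNbrs_eq (h : HangsAt ψ y c) (hc : c ∈ D → ψ y ∈ D) {v : W}
    (hv : v = y → c ∉ privateNbrs p G D (ψ y)) :
    (privateNbrs p G D (ψ v)).ncard = (privateNbrs p H (ψ ⁻¹' D) v).ncard := by
  rw [← Set.ncard_image_of_injective _ ψ.injective]
  congr 1
  ext w
  constructor
  · intro hw
    rcases h.only v w hw.2.1 with ⟨u, rfl⟩ | ⟨rfl, rfl⟩
    · exact ⟨u, (h.mem_privateNbrs_iff hc).1 hw, rfl⟩
    · exact absurd hw (hv rfl)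
  · rintro ⟨u, hu, rfl⟩
    exact (h.mem_privateNbrs_iff hc).2 hu

theorem HangsAt.ncard_privateNbrs_succ [Finite V] (h : HangsAt ψ y c)
    (hc : c ∈ privateNbrs p G D (ψ y)) :
    (privateNbrs p G D (ψ y)).ncard = (privateNbrs p H (ψ ⁻¹' D) y).ncard + 1 := by
  have hc' : c ∈ D → ψ y ∈ D := fun hcD => absurd hcD hc.1
  rw [← Set.ncard_image_of_injective _ ψ.injective,
    ← Set.ncard_insert_of_notMem (a := c) _ (Set.toFinite _)]
  · congr 1
    ext w
    constructor
    · intro hw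
      rcases h.only y w hw.2.1 with ⟨u, rfl⟩ | ⟨-, rfl⟩
      · exact Or.inr ⟨u, (h.mem_privateNbrs_iff hc').1 hw, rfl⟩
      · exact Or.inl rfl
    · rintro (rfl | ⟨u, hu, rfl⟩)
      · exact hc
      · exact (h.mem_privateNbrs_iff hc').2 hu
  · rintro ⟨w, -, rfl⟩
    exact h.not_mem ⟨w, rfl⟩

/-- A vertex without neighbours in `D` satisfies the tightness condition as soon as it has a
private neighbour. -/
theorem tight_of_domCount_eq_zero [Finite V] {x w : V} (h0 : domCount G D x = 0) (hw : w ∉ D)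
    (hadj : G.Adj x w) (hc : domCount G D w = p) :
    min (p + 1) (domCount G D x + 1) ≤ (privateNbrs p G D x).ncard := by
  have : 0 < (privateNbrs p G D x).ncard := (Set.ncard_pos).2 ⟨w, hw, hadj, hc⟩
  omega

/-- A `p`-dominating set all of whose elements have degree less than `p` is the unique
`γ_p`-set. -/
theorem isUniqueGammaSet_of_degree_lt [Finite V] (hD : IsPDominating p G D)
    (hdeg : ∀ v ∈ D, (G.neighborSet v).ncard < p) : IsUniqueGammaSet p G D := by
  -- A vertex of degree below `p` cannot be dominated from outside, so it belongs to every
  -- `p`-dominating set.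
  have key : ∀ S : Set V, IsPDominating p G S → D ⊆ S := by
    intro S hS v hv
    by_contra hvS
    have h1 := hS v hvS
    have h2 := hdeg v hv
    have h3 : (G.neighborSet v ∩ S).ncard ≤ (G.neighborSet v).ncard :=
      Set.ncard_le_ncard Set.inter_subset_left
    omega
  have hdom : D.ncard = domNum p G := by
    refine le_antisymm ?_ (domNum_le hD)
    obtain ⟨S, h1, h2⟩ := Nat.sInf_mem (s := {n | ∃ S : Set V, IsPDominating p G S ∧ S.ncard = n})
      ⟨_, D, hD, rfl⟩
    rw [domNum, ← h2]
    exact Set.ncard_le_ncard (key S h1)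
  intro S
  constructor
  · rintro ⟨h1, h2⟩
    exact (Set.eq_of_subset_of_ncard_le (key S h1) (h2.trans hdom.symm).le).symm
  · rintro rfl
    exact ⟨hD, hdom⟩

theorem IsUniqueGammaSet.eq {D' : Set V} (h : IsUniqueGammaSet p G D)
    (h' : IsUniqueGammaSet p G D') : D' = D :=
  (h D').1 ((h' D').2 rfl)

end Hanging

/-! ### Joining two graphs by an edge -/

section JoinEdge

variable {V W : Type} {G : SimpleGraph V} {H : SimpleGraph W} {x : V} {y : W}

@[simp] theorem joinEdge_inl_inl {a b : V} :
    (joinEdge G H x y).Adj (Sum.inl a) (Sum.inl b) ↔ G.Adj a b := by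
  simp [joinEdge, SimpleGraph.edge_adj]

@[simp] theorem joinEdge_inr_inr {a b : W} :
    (joinEdge G H x y).Adj (Sum.inr a) (Sum.inr b) ↔ H.Adj a b := by
  simp [joinEdge, SimpleGraph.edge_adj]

@[simp] theorem joinEdge_inl_inr {a : V} {b : W} :
    (joinEdge G H x y).Adj (Sum.inl a) (Sum.inr b) ↔ a = x ∧ b = y := by
  simp [joinEdge, SimpleGraph.edge_adj]

@[simp] theorem joinEdge_inr_inl {a : V} {b : W} :
    (joinEdge G H x y).Adj (Sum.inr b) (Sum.inl a) ↔ b = y ∧ a = x := by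
  simp [joinEdge, SimpleGraph.edge_adj]

variable (G H x y)

/-- The embedding of the first graph into `joinEdge`. -/
def joinEdgeInl : G ↪g joinEdge G H x y := ⟨⟨Sum.inl, Sum.inl_injective⟩, joinEdge_inl_inl⟩

/-- The embedding of the second graph into `joinEdge`. -/
def joinEdgeInr : H ↪g joinEdge G H x y := ⟨⟨Sum.inr, Sum.inr_injective⟩, joinEdge_inr_inr⟩

theorem joinEdgeInl_apply (a : V) : joinEdgeInl G H x y a = Sum.inl a := rfl

theorem joinEdgeInr_apply (a : W) : joinEdgeInr G H x y a = Sum.inr a := rfl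

theorem hangsAt_joinEdgeInl : HangsAt (joinEdgeInl G H x y) x (Sum.inr y) where
  adj := joinEdge_inl_inr.2 ⟨rfl, rfl⟩
  not_mem := by rintro ⟨w, hw⟩; cases hw
  only v w h := by
    rcases w with w | w
    · exact Or.inl ⟨w, rfl⟩
    · rw [joinEdgeInl_apply, joinEdge_inl_inr] at h
      exact Or.inr ⟨h.1, by rw [h.2]⟩

theorem hangsAt_joinEdgeInr : HangsAt (joinEdgeInr G H x y) y (Sum.inl x) where
  adj := joinEdge_inr_inl.2 ⟨rfl, rfl⟩
  not_mem := by rintro ⟨w, hw⟩; cases hw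
  only v w h := by
    rcases w with w | w
    · rw [joinEdgeInr_apply, joinEdge_inr_inl] at h
      exact Or.inr ⟨h.1, by rw [h.2]⟩
    · exact Or.inl ⟨w, rfl⟩

variable {G H x y}

theorem preimage_joinEdgeInl (D : Set V) (A : Set W) :
    joinEdgeInl G H x y ⁻¹' (Sum.inl '' D ∪ Sum.inr '' A) = D := by
  ext a; simp [joinEdgeInl_apply]

theorem preimage_joinEdgeInr (D : Set V) (A : Set W) :
    joinEdgeInr G H x y ⁻¹' (Sum.inl '' D ∪ Sum.inr '' A) = A := by
  ext a; simp [joinEdgeInr_apply]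

variable {p : ℕ} {D : Set V} {A : Set W}

theorem domCount_joinEdge_inl {a : V} (h : y ∈ A → a ≠ x) :
    domCount (joinEdge G H x y) (Sum.inl '' D ∪ Sum.inr '' A) (Sum.inl a) = domCount G D a := by
  have := (hangsAt_joinEdgeInl G H x y).domCount_eq (D := Sum.inl '' D ∪ Sum.inr '' A) (v := a)
    (by simpa using h)
  rwa [preimage_joinEdgeInl] at this

theorem domCount_joinEdge_inr {b : W} (h : x ∈ D → b ≠ y) :
    domCount (joinEdge G H x y) (Sum.inl '' D ∪ Sum.inr '' A) (Sum.inr b) = domCount H A b := by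
  have := (hangsAt_joinEdgeInr G H x y).domCount_eq (D := Sum.inl '' D ∪ Sum.inr '' A) (v := b)
    (by simpa using h)
  rwa [preimage_joinEdgeInr] at this

variable [Finite V] [Finite W]

theorem domCount_joinEdge_inl_succ (h : y ∈ A) :
    domCount (joinEdge G H x y) (Sum.inl '' D ∪ Sum.inr '' A) (Sum.inl x) =
      domCount G D x + 1 := by
  have := (hangsAt_joinEdgeInl G H x y).domCount_succ (D := Sum.inl '' D ∪ Sum.inr '' A)
    (by simpa using h)
  rwa [preimage_joinEdgeInl] at this

theorem domCount_joinEdge_inr_succ (h : x ∈ D) :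
    domCount (joinEdge G H x y) (Sum.inl '' D ∪ Sum.inr '' A) (Sum.inr y) =
      domCount H A y + 1 := by
  have := (hangsAt_joinEdgeInr G H x y).domCount_succ (D := Sum.inl '' D ∪ Sum.inr '' A)
    (by simpa using h)
  rwa [preimage_joinEdgeInr] at this

theorem ncard_privateNbrs_joinEdge_inr_le (h : x ∈ D → y ∈ A) (b : W) :
    (privateNbrs p H A b).ncard ≤
      (privateNbrs p (joinEdge G H x y) (Sum.inl '' D ∪ Sum.inr '' A) (Sum.inr b)).ncard := by
  have := (hangsAt_joinEdgeInr G H x y).ncard_privateNbrs_le (p := p)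
    (D := Sum.inl '' D ∪ Sum.inr '' A) (by simpa [joinEdgeInr_apply] using h) b
  rwa [preimage_joinEdgeInr] at this

/-- Attaching a piece that satisfies the tightness conditions inside the joined graph preserves
tightness, if the old attaching vertex can afford a marked neighbour. -/
theorem IsTight.joinEdge (hA : IsTight p H A) (hxy : x ∈ D → y ∈ A)
    (hdom : ∀ a, a ∉ D → p ≤ domCount (joinEdge G H x y) (Sum.inl '' D ∪ Sum.inr '' A) (Sum.inl a))
    (htight : ∀ a, a ∈ D → min (p + 1)
      (domCount (joinEdge G H x y) (Sum.inl '' D ∪ Sum.inr '' A) (Sum.inl a) + 1) ≤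
      (privateNbrs p (joinEdge G H x y) (Sum.inl '' D ∪ Sum.inr '' A) (Sum.inl a)).ncard)
    (hy : x ∈ D → min (p + 1) (domCount H A y + 2) ≤ (privateNbrs p H A y).ncard) :
    IsTight p (joinEdge G H x y) (Sum.inl '' D ∪ Sum.inr '' A) where
  dom := by
    rintro (a | b) h
    · exact hdom a (by simpa using h)
    · have hb : b ∉ A := by simpa using h
      rw [domCount_joinEdge_inr]
      · exact hA.dom b hb
      · rintro hx rfl
        exact hb (hxy hx)
  tight := by
    rintro (a | b) h
    · exact htight a (by simpa using h)
    · have hb : b ∈ A := by simpa using h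
      -- Private neighbourhoods of old vertices can only grow, and `y` alone may get a new marked
      -- neighbour.
      refine le_trans ?_ (ncard_privateNbrs_joinEdge_inr_le hxy b)
      by_cases hx : x ∈ D ∧ b = y
      · obtain ⟨hx, rfl⟩ := hx
        rw [domCount_joinEdge_inr_succ hx]
        exact hy hx
      · rw [domCount_joinEdge_inr (fun h1 h2 => hx ⟨h1, h2⟩)]
        exact hA.tight b hb

end JoinEdge

/-! ### The building blocks and their marked sets -/

section Star

theorem neighborSet_starK_inl (m : ℕ) : (starK m).neighborSet (Sum.inl ()) = Set.range Sum.inr := by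
  ext (a | a) <;> simp [starK]

theorem neighborSet_starK_inr (m : ℕ) (i : Fin m) :
    (starK m).neighborSet (Sum.inr i) = {Sum.inl ()} := by
  ext (a | a) <;> simp [starK]

theorem ncard_range_inr (m : ℕ) : (Set.range (Sum.inr : Fin m → Unit ⊕ Fin m)).ncard = m := by
  rw [← Set.image_univ, Set.ncard_image_of_injective _ Sum.inr_injective, Set.ncard_univ]
  simp

theorem leafSet_starK {m : ℕ} (hm : 2 ≤ m) : leafSet (starK m) = Set.range Sum.inr := by
  ext (⟨⟩ | i)
  · refine iff_of_false (fun h => ?_) (by simp)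
    change ((starK m).neighborSet (Sum.inl ())).ncard = 1 at h
    rw [neighborSet_starK_inl, ncard_range_inr] at h
    omega
  · simp [leafSet, neighborSet_starK_inr]

theorem domCount_starK_inl (m : ℕ) :
    domCount (starK m) (Set.range Sum.inr) (Sum.inl ()) = m := by
  rw [domCount, neighborSet_starK_inl, Set.inter_self, ncard_range_inr]

theorem domCount_starK_inr (m : ℕ) (i : Fin m) :
    domCount (starK m) (Set.range Sum.inr) (Sum.inr i) = 0 := by
  rw [domCount, neighborSet_starK_inr]
  simp

theorem isTight_starK (p : ℕ) : IsTight p (starK p) (Set.range Sum.inr) where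
  dom := by
    rintro (⟨⟩ | i) h
    · exact (domCount_starK_inl p).ge
    · simp at h
  tight := by
    rintro _ ⟨i, rfl⟩
    exact tight_of_domCount_eq_zero (w := Sum.inl ()) (domCount_starK_inr p i) (by simp)
      (by simp [starK]) (domCount_starK_inl p)

end Star

section AttachLeaves

variable {V ι : Type} {G : SimpleGraph V} {f : ι → V} {m : ℕ}

@[simp] theorem attachLeaves_inl_inl {a b : V} :
    (attachLeaves G f m).Adj (Sum.inl a) (Sum.inl b) ↔ G.Adj a b := by
  simp only [attachLeaves, SimpleGraph.fromRel_adj, G.adj_comm b a, or_self]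
  exact ⟨fun h => h.2, fun h => ⟨by simpa using h.ne, h⟩⟩

@[simp] theorem attachLeaves_inl_inr {a : V} {q : ι × Fin m} :
    (attachLeaves G f m).Adj (Sum.inl a) (Sum.inr q) ↔ a = f q.1 := by
  simp [attachLeaves, SimpleGraph.fromRel_adj]

@[simp] theorem attachLeaves_inr_inl {a : V} {q : ι × Fin m} :
    (attachLeaves G f m).Adj (Sum.inr q) (Sum.inl a) ↔ a = f q.1 := by
  rw [SimpleGraph.adj_comm, attachLeaves_inl_inr]

@[simp] theorem attachLeaves_inr_inr {q q' : ι × Fin m} :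
    ¬ (attachLeaves G f m).Adj (Sum.inr q) (Sum.inr q') := by
  simp [attachLeaves, SimpleGraph.fromRel_adj]

theorem neighborSet_attachLeaves_inr (q : ι × Fin m) :
    (attachLeaves G f m).neighborSet (Sum.inr q) = {Sum.inl (f q.1)} := by
  ext (a | a) <;> simp

theorem domCount_attachLeaves_inr {D : Set V} {q : ι × Fin m} (h : f q.1 ∉ D) :
    domCount (attachLeaves G f m) (Sum.inl '' D ∪ Set.range Sum.inr) (Sum.inr q) = 0 := by
  rw [domCount, neighborSet_attachLeaves_inr, Set.singleton_inter_eq_empty.2 (by simpa using h),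
    Set.ncard_empty]

theorem domCount_attachLeaves_of_notMem {D : Set V} {a : V} (h : ∀ i, a ≠ f i) :
    domCount (attachLeaves G f m) (Sum.inl '' D ∪ Set.range Sum.inr) (Sum.inl a) =
      domCount G D a := by
  rw [domCount, domCount, ← Set.ncard_image_of_injective _ Sum.inl_injective (β := V ⊕ (ι × Fin m))]
  congr 1
  ext (b | b) <;> simp [h]

theorem domCount_attachLeaves [Finite V] [Finite ι] {D : Set V} (hf : Function.Injective f)
    (i : ι) : domCount (attachLeaves G f m) (Sum.inl '' D ∪ Set.range Sum.inr) (Sum.inl (f i)) =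
      domCount G D (f i) + m := by
  have e : (attachLeaves G f m).neighborSet (Sum.inl (f i)) ∩ (Sum.inl '' D ∪ Set.range Sum.inr) =
      Sum.inl '' (G.neighborSet (f i) ∩ D) ∪ (fun j : Fin m => Sum.inr (i, j)) '' Set.univ := by
    ext (b | ⟨i', j⟩)
    · simp
    · simp [hf.eq_iff]
  rw [domCount, e, Set.ncard_union_eq, Set.ncard_image_of_injective _ Sum.inl_injective,
    Set.ncard_image_of_injective, Set.ncard_univ]
  · simp [domCount]
  · intro a b hab
    simpa using hab
  · rw [Set.disjoint_left]
    rintro _ ⟨b, -, rfl⟩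
    simp

end AttachLeaves

theorem ncard_pair_le {α : Type*} (a b : α) : ({a, b} : Set α).ncard ≤ 2 := by
  have := Set.ncard_insert_le a {b}
  rwa [Set.ncard_singleton] at this

section TreeF

/-- The `γ_p`-set of `F_{p-1}`. -/
def treeFSet (m : ℕ) : Set (Fin 3 ⊕ (Fin 2 × Fin m)) := Sum.inl '' {1} ∪ Set.range Sum.inr

theorem domCount_pathGraph_three {i : Fin 3} (hi : i ≠ 1) :
    domCount (SimpleGraph.pathGraph 3) {1} i = 1 := by
  rw [domCount, Set.inter_eq_right.2, Set.ncard_singleton]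
  rw [Set.singleton_subset_iff, SimpleGraph.mem_neighborSet, SimpleGraph.pathGraph_adj]
  fin_cases i <;> simp_all

theorem ends_injective : Function.Injective (![0, 2] : Fin 2 → Fin 3) := by decide

theorem ends_ne (i : Fin 2) : (![0, 2] : Fin 2 → Fin 3) i ≠ 1 := by revert i; decide

theorem domCount_treeF_end (m : ℕ) {i : Fin 3} (hi : i ≠ 1) :
    domCount (treeF m) (treeFSet m) (Sum.inl i) = m + 1 := by
  obtain ⟨j, rfl⟩ : ∃ j : Fin 2, ![0, 2] j = i := by revert i; decide
  rw [treeFSet, domCount_attachLeaves ends_injective, domCount_pathGraph_three hi, add_comm]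

theorem domCount_treeF_center (m : ℕ) : domCount (treeF m) (treeFSet m) (Sum.inl 1) = 0 := by
  rw [treeFSet, domCount_attachLeaves_of_notMem (fun i => (ends_ne i).symm), domCount]
  simp

theorem domCount_treeF_leaf (m : ℕ) (q : Fin 2 × Fin m) :
    domCount (treeF m) (treeFSet m) (Sum.inr q) = 0 :=
  domCount_attachLeaves_inr (by simpa using ends_ne q.1)

theorem inl_notMem_treeFSet {m : ℕ} {i : Fin 3} : Sum.inl i ∉ treeFSet m ↔ i ≠ 1 := by
  simp [treeFSet]

theorem isUniqueGammaSet_treeFSet {p : ℕ} (hp : 3 ≤ p) :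
    IsUniqueGammaSet p (treeF (p - 1)) (treeFSet (p - 1)) := by
  refine isUniqueGammaSet_of_degree_lt ?_ ?_
  · rintro (i | q) h
    · rw [← domCount, domCount_treeF_end _ (inl_notMem_treeFSet.1 h)]
      omega
    · simp [treeFSet] at h
  · rintro (i | q) h
    · have hi : i = 1 := by simpa [treeFSet] using h
      subst hi
      have : (treeF (p - 1)).neighborSet (Sum.inl 1) ⊆ {Sum.inl 0, Sum.inl 2} := by
        rintro (a | a) ha
        · simp [SimpleGraph.pathGraph_adj] at ha
          fin_cases a <;> simp_all
        · rw [SimpleGraph.mem_neighborSet, attachLeaves_inl_inr] at ha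
          exact absurd ha.symm (ends_ne a.1)
      have := (Set.ncard_le_ncard this).trans (ncard_pair_le _ _)
      omega
    · rw [neighborSet_attachLeaves_inr, Set.ncard_singleton]
      omega

end TreeF

section TreeFTwo

/-- The `γ_p`-set of `F_{t,p-1}`. -/
def treeFTwoSet (t m : ℕ) : Set (((Unit ⊕ Fin t) ⊕ (Fin t × Fin 1)) ⊕ (Fin t × Fin m)) :=
  Sum.inl '' (Sum.inl '' Set.range Sum.inr) ∪ Set.range Sum.inr

theorem domCount_spider_center (t : ℕ) :
    domCount (spider t) (Sum.inl '' Set.range Sum.inr) (Sum.inl (Sum.inl ())) = t := by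
  rw [domCount]
  have : (spider t).neighborSet (Sum.inl (Sum.inl ())) ∩ (Sum.inl '' Set.range Sum.inr) =
      Sum.inl '' Set.range Sum.inr := by
    rw [Set.inter_eq_right]
    rintro _ ⟨_, ⟨i, rfl⟩, rfl⟩
    simp [starK]
  rw [this, Set.ncard_image_of_injective _ Sum.inl_injective, ncard_range_inr]

theorem domCount_spider_foot (t : ℕ) (q : Fin t × Fin 1) :
    domCount (spider t) (Sum.inl '' Set.range Sum.inr) (Sum.inr q) = 1 := by
  rw [domCount, neighborSet_attachLeaves_inr, Set.inter_eq_left.2 (by simp), Set.ncard_singleton]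

theorem domCount_spider_leg (t : ℕ) (i : Fin t) :
    domCount (spider t) (Sum.inl '' Set.range Sum.inr) (Sum.inl (Sum.inr i)) = 0 := by
  rw [domCount, Set.ncard_eq_zero, Set.eq_empty_iff_forall_notMem]
  rintro _ ⟨h, _, ⟨j, rfl⟩, rfl⟩
  simp [starK] at h

theorem foot_injective (t : ℕ) : Function.Injective
    (fun i => Sum.inr (i, 0) : Fin t → (Unit ⊕ Fin t) ⊕ (Fin t × Fin 1)) := by
  intro i j h
  simpa using h

variable (t m : ℕ)

theorem domCount_treeFTwo_center : domCount (treeF₂ t m) (treeFTwoSet t m)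
    (Sum.inl (Sum.inl (Sum.inl ()))) = t := by
  rw [treeFTwoSet, domCount_attachLeaves_of_notMem (by simp), domCount_spider_center]

theorem domCount_treeFTwo_leg (i : Fin t) : domCount (treeF₂ t m) (treeFTwoSet t m)
    (Sum.inl (Sum.inl (Sum.inr i))) = 0 := by
  rw [treeFTwoSet, domCount_attachLeaves_of_notMem (by simp), domCount_spider_leg]

theorem domCount_treeFTwo_foot (i : Fin t) : domCount (treeF₂ t m) (treeFTwoSet t m)
    (Sum.inl (Sum.inr (i, 0))) = m + 1 := by
  rw [treeFTwoSet, domCount_attachLeaves (foot_injective t) i, domCount_spider_foot, add_comm]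

theorem domCount_treeFTwo_leaf (q : Fin t × Fin m) : domCount (treeF₂ t m) (treeFTwoSet t m)
    (Sum.inr q) = 0 :=
  domCount_attachLeaves_inr (by simp)

theorem isUniqueGammaSet_treeFTwoSet {p t : ℕ} (hp : 3 ≤ p) (ht : p ≤ t) :
    IsUniqueGammaSet p (treeF₂ t (p - 1)) (treeFTwoSet t (p - 1)) := by
  refine isUniqueGammaSet_of_degree_lt ?_ ?_
  · rintro (((⟨⟩ | i) | ⟨i, j⟩) | q) h
    · exact ht.trans (domCount_treeFTwo_center t _).ge
    · simp [treeFTwoSet] at h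
    · obtain rfl := Subsingleton.elim j 0
      have := domCount_treeFTwo_foot t (p - 1) i
      rw [← domCount]
      omega
    · simp [treeFTwoSet] at h
  · rintro (((⟨⟩ | i) | ⟨i, j⟩) | q) h
    · simp [treeFTwoSet] at h
    · have : (treeF₂ t (p - 1)).neighborSet (Sum.inl (Sum.inl (Sum.inr i))) ⊆
          {Sum.inl (Sum.inl (Sum.inl ())), Sum.inl (Sum.inr (i, 0))} := by
        rintro (((⟨⟩ | i') | ⟨i', j⟩) | q) ha
        · simp
        · simp [starK] at ha
        · obtain rfl := Subsingleton.elim j 0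
          simp at ha
          simp [ha]
        · simp at ha
      have := (Set.ncard_le_ncard this).trans (ncard_pair_le _ _)
      omega
    · simp [treeFTwoSet] at h
    · rw [neighborSet_attachLeaves_inr, Set.ncard_singleton]
      omega

end TreeFTwo

/-! ### Constructed trees have tight marked sets -/

section Built

theorem Built.finite {p k : ℕ} {V : Type} {T : SimpleGraph V} {A : Set V} (h : Built p k V T A) :
    Finite V := by
  induction h <;> infer_instance

theorem Built.isTight {p k : ℕ} (hp : 3 ≤ p) {V : Type} {T : SimpleGraph V} {A : Set V}
    (h : Built p k V T A) : IsTight p T A := by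
  induction h with
  | base =>
    rw [leafSet_starK (by omega)]
    exact isTight_starK p
  | @op₁ k V T A h y hy ih =>
    have := h.finite
    rw [leafSet_starK (by omega)]
    -- The `p - 1` leaves together with `y` give the new centre exactly `p` marked neighbours, so it
    -- is private for each new leaf.
    have hc := domCount_joinEdge_inl_succ (G := starK (p - 1)) (H := T) (x := Sum.inl ())
      (D := Set.range Sum.inr) hy
    rw [domCount_starK_inl, Nat.sub_add_cancel (by omega)] at hc
    refine ih.joinEdge (by simp) ?_ ?_ (by simp)
    · rintro (⟨⟩ | i) h
      · exact hc.ge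
      · simp at h
    · rintro _ ⟨i, rfl⟩
      refine tight_of_domCount_eq_zero (w := Sum.inl (Sum.inl ())) ?_ (by simp)
        (by simp [starK]) hc
      rw [domCount_joinEdge_inl (by simp), domCount_starK_inr]
  | @op₂ k V T A h y hy ih =>
    have := h.finite
    rw [leafSet_starK (by omega)]
    have hc := domCount_joinEdge_inl (G := starK p) (H := T) (x := Sum.inl ()) (a := Sum.inl ())
      (D := Set.range Sum.inr) (fun h => absurd h hy)
    rw [domCount_starK_inl] at hc
    refine ih.joinEdge (by simp) ?_ ?_ (by simp)
    · rintro (⟨⟩ | i) h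
      · exact hc.ge
      · simp at h
    · rintro _ ⟨i, rfl⟩
      refine tight_of_domCount_eq_zero (w := Sum.inl (Sum.inl ())) ?_ (by simp)
        (by simp [starK]) hc
      rw [domCount_joinEdge_inl (by simp), domCount_starK_inr]
  | @op₃ k V T A h y hy hPN D hD ih =>
    have := h.finite
    obtain rfl := (isUniqueGammaSet_treeFSet hp).eq hD
    have hend : ∀ i : Fin 3, i ≠ 1 → domCount (joinEdge (treeF (p - 1)) T (Sum.inl 1) y)
        (Sum.inl '' treeFSet (p - 1) ∪ Sum.inr '' A) (Sum.inl (Sum.inl i)) = p := by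
      intro i hi
      rw [domCount_joinEdge_inl (by simpa using fun _ => hi), domCount_treeF_end _ hi]
      omega
    -- The side condition `hPN` is the tightness required of `y` once it has one more marked
    -- neighbour.
    refine ih.joinEdge (fun _ => hy) ?_ ?_ (fun _ => hPN)
    · rintro (i | q) h
      · exact (hend i (inl_notMem_treeFSet.1 h)).ge
      · simp [treeFSet] at h
    · rintro (i | q) h
      · have hi : i = 1 := by simpa [treeFSet] using h
        subst hi
        rw [domCount_joinEdge_inl_succ hy, domCount_treeF_center]
        -- The marked centre has `y` as its only marked neighbour, so it needs two private
        -- neighbours: the ends of the path.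
        have hsub : {Sum.inl (Sum.inl 0), Sum.inl (Sum.inl 2)} ⊆
            privateNbrs p (joinEdge (treeF (p - 1)) T (Sum.inl 1) y)
              (Sum.inl '' treeFSet (p - 1) ∪ Sum.inr '' A) (Sum.inl (Sum.inl 1)) := by
          rintro _ (rfl | rfl)
          · exact ⟨by simp [treeFSet], by simp [SimpleGraph.pathGraph_adj], hend 0 (by simp)⟩
          · exact ⟨by simp [treeFSet], by simp [SimpleGraph.pathGraph_adj], hend 2 (by simp)⟩
        have := Set.ncard_le_ncard hsub
        rw [Set.ncard_pair (by simp)] at this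
        omega
      · refine tight_of_domCount_eq_zero (w := Sum.inl (Sum.inl (![0, 2] q.1))) ?_ ?_ ?_
          (hend _ (ends_ne _))
        · rw [domCount_joinEdge_inl (by simp), domCount_treeF_leaf]
        · simpa [treeFSet] using ends_ne q.1
        · simp
  | @op₄ k V T A h t ht y D hD ih =>
    have := h.finite
    obtain rfl := (isUniqueGammaSet_treeFTwoSet hp ht).eq hD
    have hfoot : ∀ i : Fin t, domCount
        (joinEdge (treeF₂ t (p - 1)) T (Sum.inl (Sum.inl (Sum.inl ()))) y)
        (Sum.inl '' treeFTwoSet t (p - 1) ∪ Sum.inr '' A) (Sum.inl (Sum.inl (Sum.inr (i, 0)))) =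
          p := by
      intro i
      rw [domCount_joinEdge_inl (by simp), domCount_treeFTwo_foot]
      omega
    -- The centre is unmarked and already has `t ≥ p` marked neighbours, so it does not matter
    -- whether `y` is marked.
    refine ih.joinEdge (by simp [treeFTwoSet]) ?_ ?_ (by simp [treeFTwoSet])
    · rintro (((⟨⟩ | i) | ⟨i, j⟩) | q) h
      · by_cases hy : y ∈ A
        · rw [domCount_joinEdge_inl_succ hy, domCount_treeFTwo_center]
          omega
        · rw [domCount_joinEdge_inl (fun h => absurd h hy), domCount_treeFTwo_center]
          omega
      · simp [treeFTwoSet] at h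
      · obtain rfl := Subsingleton.elim j 0
        exact (hfoot i).ge
      · simp [treeFTwoSet] at h
    · rintro (((⟨⟩ | i) | ⟨i, j⟩) | q) h
      · simp [treeFTwoSet] at h
      · refine tight_of_domCount_eq_zero (w := Sum.inl (Sum.inl (Sum.inr (i, 0)))) ?_
          (by simp [treeFTwoSet]) (by simp) (hfoot i)
        rw [domCount_joinEdge_inl (by simp), domCount_treeFTwo_leg]
      · simp [treeFTwoSet] at h
      · refine tight_of_domCount_eq_zero (w := Sum.inl (Sum.inl (Sum.inr (q.1, 0)))) ?_
          (by simp [treeFTwoSet]) (by simp) (hfoot q.1)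
        rw [domCount_joinEdge_inl (by simp), domCount_treeFTwo_leaf]

theorem ncard_lt_ncard_inl_union_inr {V W : Type} [Finite V] [Finite W] {D : Set V} {A : Set W}
    (hD : D.Nonempty) : A.ncard < (Sum.inl '' D ∪ Sum.inr '' A : Set (V ⊕ W)).ncard := by
  rw [Set.ncard_union_eq, Set.ncard_image_of_injective _ Sum.inl_injective,
    Set.ncard_image_of_injective _ Sum.inr_injective]
  · have := (Set.ncard_pos (s := D)).2 hD
    omega
  · rw [Set.disjoint_left]
    rintro _ ⟨b, -, rfl⟩
    simp

/-- Each operation brings in at least one new marked vertex. This is how `k ≥ 1` yields more than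
`p` marks, hence `γ_p > p`. -/
theorem Built.add_le_ncard {p k : ℕ} (hp : 3 ≤ p) {V : Type} {T : SimpleGraph V} {A : Set V}
    (h : Built p k V T A) : p + k ≤ A.ncard := by
  induction h with
  | base =>
    rw [leafSet_starK (by omega), ncard_range_inr]
    rfl
  | @op₁ k V T A h y hy ih =>
    have := h.finite
    rw [leafSet_starK (by omega)]
    have := ncard_lt_ncard_inl_union_inr (A := A)
      (⟨_, ⟨⟨0, by omega⟩, rfl⟩⟩ : (Set.range (Sum.inr : Fin (p - 1) → Unit ⊕ _)).Nonempty)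
    omega
  | @op₂ k V T A h y hy ih =>
    have := h.finite
    rw [leafSet_starK (by omega)]
    have := ncard_lt_ncard_inl_union_inr (A := A)
      (⟨_, ⟨⟨0, by omega⟩, rfl⟩⟩ : (Set.range (Sum.inr : Fin p → Unit ⊕ _)).Nonempty)
    omega
  | @op₃ k V T A h y hy hPN D hD ih =>
    have := h.finite
    obtain rfl := (isUniqueGammaSet_treeFSet hp).eq hD
    have := ncard_lt_ncard_inl_union_inr (A := A)
      (⟨Sum.inl 1, by simp [treeFSet]⟩ : (treeFSet (p - 1)).Nonempty)
    omega
  | @op₄ k V T A h t ht y D hD ih =>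
    have := h.finite
    obtain rfl := (isUniqueGammaSet_treeFTwoSet hp ht).eq hD
    have := ncard_lt_ncard_inl_union_inr (A := A)
      (⟨Sum.inl (Sum.inl (Sum.inr ⟨0, by omega⟩)), by simp [treeFTwoSet]⟩ :
        (treeFTwoSet t (p - 1)).Nonempty)
    omega

theorem Built.ncard_zero {p : ℕ} (hp : 3 ≤ p) {V : Type} {T : SimpleGraph V} {A : Set V}
    (h : Built p 0 V T A) : A.ncard = p := by
  cases h
  rw [leafSet_starK (by omega), ncard_range_inr]

end Built

/-! ### Transfer of tightness to isomorphic graphs and to parts -/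

section Iso

variable {V W : Type*} {G : SimpleGraph V} {H : SimpleGraph W} {D : Set V} {p : ℕ}

theorem domCount_iso (e : G ≃g H) (v : V) : domCount H (e '' D) (e v) = domCount G D v := by
  rw [domCount, domCount, ← Set.ncard_image_of_injective _ e.injective]
  congr 1
  ext w
  obtain ⟨w, rfl⟩ := e.surjective w
  rw [e.injective.mem_set_image]
  exact and_congr e.map_adj_iff e.injective.mem_set_image

theorem ncard_privateNbrs_iso (e : G ≃g H) (v : V) :
    (privateNbrs p H (e '' D) (e v)).ncard = (privateNbrs p G D v).ncard := by
  rw [← Set.ncard_image_of_injective _ e.injective]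
  congr 1
  ext w
  obtain ⟨w, rfl⟩ := e.surjective w
  have := domCount_iso (D := D) e w
  rw [e.injective.mem_set_image]
  exact and_congr (not_congr e.injective.mem_set_image)
    (and_congr e.map_adj_iff (by rw [← domCount, this, domCount]))

theorem IsTight.iso (h : IsTight p G D) (e : G ≃g H) : IsTight p H (e '' D) where
  dom := by
    intro w hw
    obtain ⟨w, rfl⟩ := e.surjective w
    rw [domCount_iso]
    exact h.dom w (by simpa using hw)
  tight := by
    intro w hw
    obtain ⟨w, rfl⟩ := e.surjective w
    rw [domCount_iso, ncard_privateNbrs_iso]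
    exact h.tight w (by simpa using hw)

/-- Tightness is inherited by a part of the graph that hangs at a single edge, if the vertex that
is attached to the rest does not lose a private neighbour that it needs. -/
theorem IsTight.of_hangsAt [Finite V] {ψ : H ↪g G} {y : W} {c : V} (hD : IsTight p G D)
    (h : HangsAt ψ y c) (hc : c ∈ D → ψ y ∈ D)
    (hy : ψ y ∈ D → c ∈ privateNbrs p G D (ψ y) →
      min (p + 1) (domCount G D (ψ y) + 1) + 1 ≤ (privateNbrs p G D (ψ y)).ncard) :
    IsTight p H (ψ ⁻¹' D) where
  dom v hv := by
    rw [← h.domCount_eq]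
    · exact hD.dom _ hv
    · rintro hcD rfl
      exact hv (hc hcD)
  tight v hv := by
    by_cases hvy : v = y
    · subst hvy
      by_cases hcp : c ∈ privateNbrs p G D (ψ v)
      · have h1 := h.ncard_privateNbrs_succ hcp
        have h2 := h.domCount_eq (v := v) (fun hcD => absurd hcD hcp.1)
        have h3 := hy hv hcp
        omega
      · have h1 := h.ncard_privateNbrs_eq hc (v := v) (fun _ => hcp)
        have h3 := hD.tight _ hv
        by_cases hcD : c ∈ D
        · have h2 := h.domCount_succ hcD
          omega
        · have h2 := h.domCount_eq (v := v) (fun h => absurd h hcD)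
          omega
    · rw [← h.domCount_eq (fun _ => hvy), ← h.ncard_privateNbrs_eq hc (fun h => absurd h hvy)]
      exact hD.tight _ hv

end Iso

/-! ### Descendants in a rooted tree -/

section Rooted

variable {V : Type*} (T : SimpleGraph V) (r : V)

/-- `b` is a child of `a` when `T` is rooted at `r`. -/
def IsChild (a b : V) : Prop := T.Adj a b ∧ T.dist r b = T.dist r a + 1

/-- The descendants of `c`, including `c`, when `T` is rooted at `r`. -/
def desc (c : V) : Set V := {v | Relation.ReflTransGen (IsChild T r) c v}

variable {T r}

theorem self_mem_desc (c : V) : c ∈ desc T r c := Relation.ReflTransGen.refl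

theorem desc_child {c a b : V} (ha : a ∈ desc T r c) (h : IsChild T r a b) : b ∈ desc T r c :=
  Relation.ReflTransGen.tail ha h

theorem desc_subset {c : V} {U : Set V} (hc : c ∈ U)
    (hU : ∀ a ∈ U, ∀ b, IsChild T r a b → b ∈ U) : desc T r c ⊆ U := by
  intro v hv
  induction hv with
  | refl => exact hc
  | tail _ h ih => exact hU _ ih _ h

theorem dist_le_of_mem_desc {c v : V} (h : v ∈ desc T r c) : T.dist r c ≤ T.dist r v := by
  induction h with
  | refl => exact le_rfl
  | tail _ h ih => exact ih.trans (by rw [h.2]; omega)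

theorem exists_isChild (hT : T.IsTree) {u : V} (h : u ≠ r) : ∃ v, IsChild T r v u := by
  obtain ⟨v, h1, h2⟩ := exists_parent hT h
  exact ⟨v, h1.symm, h2⟩

theorem IsChild.unique (hT : T.IsTree) {a a' b : V} (h : IsChild T r a b)
    (h' : IsChild T r a' b) : a = a' :=
  parent_unique hT r h.1.symm h'.1.symm h.2 h'.2

theorem isChild_or (hT : T.IsTree) {a b : V} (h : T.Adj a b) :
    IsChild T r a b ∨ IsChild T r b a := by
  rcases dist_adj_cases hT r h with h' | h'
  · exact Or.inr ⟨h.symm, h'⟩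
  · exact Or.inl ⟨h, h'⟩

theorem not_adj_of_dist_eq (hT : T.IsTree) {a b : V} (h : T.dist r a = T.dist r b) :
    ¬ T.Adj a b := by
  intro hab
  rcases dist_adj_cases hT r hab with h' | h' <;> omega

theorem mem_desc_of_adj (hT : T.IsTree) {b c u v : V} (hbc : IsChild T r b c)
    (hu : u ∈ desc T r c) (huv : T.Adj u v) : v ∈ desc T r c ∨ (u = c ∧ v = b) := by
  rcases isChild_or hT huv with h | h
  · exact Or.inl (desc_child hu h)
  · rcases Relation.ReflTransGen.cases_tail hu with rfl | ⟨w, hw, hwu⟩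
    · exact Or.inr ⟨rfl, h.unique hT hbc⟩
    · rw [h.unique hT hwu]
      exact Or.inl hw

theorem parent_notMem_desc {b c : V} (hbc : IsChild T r b c) : b ∉ desc T r c := by
  intro h
  have := dist_le_of_mem_desc h
  have := hbc.2
  omega

/-- The parent of a non-descendant of `c` is again a non-descendant, so climbing to the root never
leaves the complement. -/
theorem isTree_induce_compl_desc (hT : T.IsTree) {b c : V} (hbc : IsChild T r b c) :
    (T.induce (desc T r c)ᶜ).IsTree := by
  refine ⟨?_, hT.isAcyclic.induce _⟩
  have hr : r ∈ (desc T r c)ᶜ := by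
    intro h
    have h1 := dist_le_of_mem_desc h
    have h2 := hbc.2
    rw [SimpleGraph.dist_self] at h1
    omega
  rw [SimpleGraph.connected_iff_exists_forall_reachable]
  refine ⟨⟨r, hr⟩, ?_⟩
  have key : ∀ n, ∀ v (hv : v ∈ (desc T r c)ᶜ), T.dist r v = n →
      (T.induce (desc T r c)ᶜ).Reachable ⟨r, hr⟩ ⟨v, hv⟩ := by
    intro n
    induction n with
    | zero =>
      intro v hv h0
      obtain rfl := hT.connected.dist_eq_zero_iff.1 h0
      exact SimpleGraph.Reachable.refl _
    | succ n ih =>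
      intro v hv hn
      obtain ⟨u, hu⟩ := exists_isChild hT (u := v) (r := r) (by rintro rfl; simp at hn)
      have hu' : u ∈ (desc T r c)ᶜ := fun h => hv (desc_child h hu)
      refine (ih u hu' (by have := hu.2; omega)).trans (SimpleGraph.Adj.reachable ?_)
      exact hu.1
  rintro ⟨v, hv⟩
  exact key _ v hv rfl

theorem hangsAt_induce_compl_desc (hT : T.IsTree) {b c : V} (hbc : IsChild T r b c) :
    HangsAt (SimpleGraph.Embedding.induce (desc T r c)ᶜ : T.induce (desc T r c)ᶜ ↪g T)
      ⟨b, parent_notMem_desc hbc⟩ c where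
  adj := hbc.1
  not_mem := by
    rintro ⟨⟨v, hv⟩, h⟩
    obtain rfl : v = c := h
    exact hv (self_mem_desc _)
  only := by
    rintro ⟨v, hv⟩ w (hvw : T.Adj v w)
    by_cases hw : w ∈ desc T r c
    · rcases mem_desc_of_adj hT hbc hw hvw.symm with h | ⟨rfl, rfl⟩
      · exact absurd h hv
      · exact Or.inr ⟨rfl, rfl⟩
    · exact Or.inl ⟨⟨w, hw⟩, rfl⟩

end Rooted

/-! ### Cutting off a branch and gluing it back -/

section Reduce

/-- `(T, D)` is, up to isomorphism, a tree with its marked set built from `K_{1,p}`. -/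
def Constructible {V : Type*} (p : ℕ) (T : SimpleGraph V) (D : Set V) : Prop :=
  ∃ (k : ℕ) (W : Type) (G : SimpleGraph W) (A : Set W),
    Built p k W G A ∧ ∃ e : T ≃g G, e '' D = A

variable {V : Type} {T : SimpleGraph V} {D : Set V} {p : ℕ}

/-- Two complementary embedded pieces with a single edge between them reassemble to the joined
graph, marks included. -/
theorem exists_iso_joinEdge {U W : Type} {H : SimpleGraph U} {G : SimpleGraph W} (φ : H ↪g T)
    (ψ : G ↪g T) {x : U} {y : W} (hψ : HangsAt ψ y (φ x)) (hr : Set.range φ = (Set.range ψ)ᶜ) :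
    ∃ e : T ≃g joinEdge H G x y, e '' D = Sum.inl '' (φ ⁻¹' D) ∪ Sum.inr '' (ψ ⁻¹' D) := by
  have hne : ∀ a b, φ a ≠ ψ b := by
    intro a b h
    have : φ a ∈ (Set.range ψ)ᶜ := hr ▸ ⟨a, rfl⟩
    exact this ⟨b, h.symm⟩
  have hbij : Function.Bijective (Sum.elim φ ψ) := by
    refine ⟨φ.injective.sumElim ψ.injective hne, fun v => ?_⟩
    by_cases hv : v ∈ Set.range ψ
    · obtain ⟨b, rfl⟩ := hv
      exact ⟨Sum.inr b, rfl⟩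
    · obtain ⟨a, rfl⟩ : v ∈ Set.range φ := hr ▸ hv
      exact ⟨Sum.inl a, rfl⟩
  have hcross : ∀ a b, T.Adj (φ a) (ψ b) ↔ a = x ∧ b = y := by
    intro a b
    constructor
    · intro h
      rcases hψ.only b _ h.symm with ⟨w, hw⟩ | ⟨rfl, h'⟩
      · exact absurd hw.symm (hne _ _)
      · exact ⟨φ.injective h', rfl⟩
    · rintro ⟨rfl, rfl⟩
      exact hψ.adj.symm
  let e : joinEdge H G x y ≃g T :=
    { toEquiv := Equiv.ofBijective _ hbij
      map_rel_iff' := by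
        rintro (a | a) (b | b)
        · exact φ.map_adj_iff.trans joinEdge_inl_inl.symm
        · exact (hcross a b).trans joinEdge_inl_inr.symm
        · exact (T.adj_comm _ _).trans
            ((hcross b a).trans (and_comm.trans joinEdge_inr_inl.symm))
        · exact ψ.map_adj_iff.trans joinEdge_inr_inr.symm }
  refine ⟨e.symm, ?_⟩
  have : e.symm '' D = e ⁻¹' D := e.symm.toEquiv.image_eq_preimage_symm D
  rw [this]
  ext (a | a) <;> simp [e]

variable [Finite V] {r : V}

/-- Common mechanism of all reductions: cut the edge `bc`, build the part without the descendants of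
`c` by induction, and glue the branch back by one operation, supplied as `hop`. The hypotheses `hcb`
and `hb` say that `b` survives the cut: if unmarked it loses no marked neighbour, and if marked it
can spare `c` as a private neighbour. -/
theorem constructible_of_desc (hT : T.IsTree) (hD : IsTight p T D)
    (IH : ∀ S : Set V, S ≠ Set.univ → (T.induce S).IsTree →
      IsTight p (T.induce S) (Subtype.val ⁻¹' D) →
      Constructible p (T.induce S) (Subtype.val ⁻¹' D))
    {b c : V} (hbc : IsChild T r b c) (hcb : c ∈ D → b ∈ D)
    (hb : b ∈ D → c ∈ privateNbrs p T D b →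
      min (p + 1) (domCount T D b + 1) + 1 ≤ (privateNbrs p T D b).ncard)
    {U : Type} {H : SimpleGraph U} (φ : H ↪g T) {x : U} (hx : φ x = c)
    (hφ : Set.range φ = desc T r c)
    (hop : ∀ {k : ℕ} {W : Type} {G : SimpleGraph W} {A : Set W} (y : W), Built p k W G A →
      (y ∈ A ↔ b ∈ D) →
      (c ∈ D → min (p + 1) (domCount G A y + 2) ≤ (privateNbrs p G A y).ncard) →
      Built p (k + 1) (U ⊕ W) (joinEdge H G x y) (Sum.inl '' (φ ⁻¹' D) ∪ Sum.inr '' A)) :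
    Constructible p T D := by
  subst hx
  have hh := hangsAt_induce_compl_desc hT hbc
  set ι := (SimpleGraph.Embedding.induce (desc T r (φ x))ᶜ : T.induce (desc T r (φ x))ᶜ ↪g T)
    with hι
  obtain ⟨k, W, G, A, hB, e, rfl⟩ := IH (desc T r (φ x))ᶜ
    (fun h => absurd (self_mem_desc (T := T) (r := r) (φ x)) (by
      rw [← Set.mem_compl_iff, h]; trivial))
    (isTree_induce_compl_desc hT hbc) (hD.of_hangsAt hh hcb hb)
  set b' : ((desc T r (φ x))ᶜ : Set V) := ⟨b, parent_notMem_desc hbc⟩ with hb'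
  have hpre : e.symm ⁻¹' (Subtype.val ⁻¹' D) = e '' (Subtype.val ⁻¹' D) :=
    (e.toEquiv.image_eq_preimage_symm _).symm
  have hψ : HangsAt (e.symm.toEmbedding.trans ι) (e b') (φ x) := by
    refine ⟨?_, ?_, ?_⟩
    · simpa using hh.adj
    · rintro ⟨w, hw⟩
      exact hh.not_mem ⟨_, hw⟩
    · intro v w hvw
      rcases hh.only (e.symm v) w hvw with ⟨u, hu⟩ | ⟨h1, h2⟩
      · exact Or.inl ⟨e u, by simpa using hu⟩
      · exact Or.inr ⟨by rw [← h1]; simp, h2⟩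
  have hr : Set.range φ = (Set.range (e.symm.toEmbedding.trans ι))ᶜ := by
    rw [hφ]
    ext v
    constructor
    · rintro hv ⟨w, rfl⟩
      exact (e.symm w).2 hv
    · intro hv
      by_contra hv'
      exact hv ⟨e ⟨v, hv'⟩, by simp [hι]⟩
  obtain ⟨f, hf⟩ := exists_iso_joinEdge (D := D) φ _ hψ hr
  have hpre' : (e.symm.toEmbedding.trans ι) ⁻¹' D = e '' (Subtype.val ⁻¹' D) := hpre
  rw [hpre'] at hf
  refine ⟨k + 1, _, _, _, hop (e b') hB ?_ ?_, f, hf⟩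
  · simp [hb']
  · intro hc
    rw [domCount_iso, ncard_privateNbrs_iso]
    -- A marked `c` counts once among the marked neighbours of `b` but is not private, so tightness
    -- of `b` in `T` becomes the condition with `+ 2` in the remaining part.
    have h1 := hh.domCount_succ hc
    have h2 := hh.ncard_privateNbrs_eq (p := p) hcb (v := b') (fun _ h => h.1 hc)
    have h3 := hD.tight b (hcb hc)
    change (privateNbrs p T D b).ncard = (privateNbrs p _ (Subtype.val ⁻¹' D) b').ncard at h2
    change domCount T D b = domCount _ (Subtype.val ⁻¹' D) b' + 1 at h1
    omega

end Reduce

/-! ### Finding the building blocks inside a tree -/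

section Embeddings

variable {V : Type*} {T : SimpleGraph V}

theorem exists_enumeration [Finite V] {s : Set V} {m : ℕ} (h : s.ncard = m) :
    ∃ f : Fin m → V, Function.Injective f ∧ Set.range f = s := by
  let e : s ≃ Fin m := Finite.equivFinOfCardEq h
  refine ⟨fun i => e.symm i, Subtype.val_injective.comp e.symm.injective, ?_⟩
  rw [show (fun i => (e.symm i : V)) = Subtype.val ∘ e.symm from rfl, Set.range_comp,
    e.symm.range_eq_univ, Set.image_univ, Subtype.range_coe]

theorem exists_starK_embedding (hT : T.IsTree) (c : V) {m : ℕ} {f : Fin m → V}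
    (hf : Function.Injective f) (hadj : ∀ i, T.Adj c (f i)) :
    ∃ φ : starK m ↪g T, φ (Sum.inl ()) = c ∧ ∀ i, φ (Sum.inr i) = f i := by
  have hnot : ∀ i j, ¬ T.Adj (f i) (f j) := fun i j => not_adj_of_dist_eq hT (r := c) (by
    rw [SimpleGraph.dist_eq_one_iff_adj.2 (hadj i), SimpleGraph.dist_eq_one_iff_adj.2 (hadj j)])
  refine ⟨⟨⟨Sum.elim (fun _ => c) f, ?_⟩, ?_⟩, rfl, fun _ => rfl⟩
  · refine Function.Injective.sumElim (fun _ _ _ => rfl) hf fun _ i => (hadj i).ne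
  · rintro (⟨⟩ | i) (⟨⟩ | j) <;> simp [starK, hadj, hnot, (hadj _).symm]

theorem exists_pathGraph_embedding (hT : T.IsTree) {a b c : V} (hab : T.Adj b a)
    (hbc : T.Adj b c) (hac : a ≠ c) :
    ∃ φ : SimpleGraph.pathGraph 3 ↪g T, φ 0 = a ∧ φ 1 = b ∧ φ 2 = c := by
  have hnot : ¬ T.Adj a c := not_adj_of_dist_eq hT (r := b) (by
    rw [SimpleGraph.dist_eq_one_iff_adj.2 hab, SimpleGraph.dist_eq_one_iff_adj.2 hbc])
  have hnot' : ¬ T.Adj c a := fun h => hnot h.symm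
  refine ⟨⟨⟨![a, b, c], ?_⟩, ?_⟩, rfl, rfl, rfl⟩
  · intro i j hij
    fin_cases i <;> fin_cases j <;>
      simp_all [hab.ne, hbc.ne, hab.ne', hbc.ne', hac.symm]
  · intro i j
    change T.Adj (![a, b, c] i) (![a, b, c] j) ↔ _
    fin_cases i <;> fin_cases j <;>
      simp [SimpleGraph.pathGraph_adj, hab, hbc, hab.symm, hbc.symm, hnot, hnot']

/-- All new vertices lie at one depth `L`, below everything embedded so far. Hence they are pairwise
nonadjacent, and each is adjacent to its parent only among the old vertices. -/
theorem exists_attachLeaves_embedding (hT : T.IsTree) {r : V} {W ι : Type} {H : SimpleGraph W}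
    (φ : H ↪g T) {f : ι → W} (hf : Function.Injective f) {m : ℕ} {g : ι → Fin m → V}
    (hg : ∀ i j, IsChild T r (φ (f i)) (g i j)) (hinj : ∀ i, Function.Injective (g i)) {L : ℕ}
    (hL : ∀ i j, T.dist r (g i j) = L) (hlt : ∀ a, T.dist r (φ a) < L) :
    ∃ φ' : attachLeaves H f m ↪g T, (∀ a, φ' (Sum.inl a) = φ a) ∧
      ∀ i j, φ' (Sum.inr (i, j)) = g i j := by
  have hnot : ∀ i j i' j', ¬ T.Adj (g i j) (g i' j') := fun i j i' j' =>
    not_adj_of_dist_eq hT (r := r) (by rw [hL, hL])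
  have hadj : ∀ a i j, T.Adj (φ a) (g i j) ↔ a = f i := by
    intro a i j
    constructor
    · intro h
      rcases isChild_or (r := r) hT h with h' | h'
      · exact φ.injective (h'.unique hT (hg i j))
      · have h1 := h'.2
        have h2 := hlt a
        rw [hL] at h1
        omega
    · rintro rfl
      exact (hg i j).1
  refine ⟨⟨⟨Sum.elim φ (fun q => g q.1 q.2), ?_⟩, ?_⟩, fun _ => rfl, fun _ _ => rfl⟩
  · refine Function.Injective.sumElim φ.injective ?_ ?_
    · rintro ⟨i, j⟩ ⟨i', j'⟩ (h : g i j = g i' j')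
      have h1 := (hadj (f i) i' j').1 (h ▸ (hg i j).1)
      obtain rfl := hf h1
      rw [hinj i h]
    · rintro a ⟨i, j⟩ h
      have := hlt a
      rw [h, hL] at this
      omega
  · rintro (a | ⟨i, j⟩) (b | ⟨i', j'⟩)
    · simp
    · simp [hadj]
    · simp [T.adj_comm (g i j), hadj]
    · simp [hnot]

end Embeddings

/-! ### Undoing an operation at the end of a longest path -/

section Reduction

variable {V : Type} [Finite V] {T : SimpleGraph V} {D : Set V} {p : ℕ} {r : V}

/-- With at most one neighbour, `v` cannot be dominated; being marked it needs a private neighbour,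
which can only be `u`. -/
theorem IsTight.leaf (hD : IsTight p T D) (hp : 3 ≤ p) {v u : V}
    (hv : ∀ w, T.Adj v w → w = u) : v ∈ D ∧ T.Adj v u ∧ u ∉ D ∧ domCount T D u = p := by
  have hvD : v ∈ D := by
    by_contra hvD
    have h1 := hD.dom v hvD
    have h2 : domCount T D v ≤ ({u} : Set V).ncard :=
      Set.ncard_le_ncard fun w hw => hv w hw.1
    rw [Set.ncard_singleton] at h2
    omega
  have h1 := hD.tight v hvD
  obtain ⟨y, hy1, hy2, hy3⟩ : (privateNbrs p T D v).Nonempty := by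
    rw [← Set.ncard_pos]
    omega
  obtain rfl := hv y hy2
  exact ⟨hvD, hy2, hy1, hy3⟩

theorem IsTight.childless (hD : IsTight p T D) (hp : 3 ≤ p) (hT : T.IsTree) {u v : V}
    (huv : IsChild T r u v) (hv : ∀ w, ¬ IsChild T r v w) :
    v ∈ D ∧ u ∉ D ∧ domCount T D u = p := by
  obtain ⟨h1, -, h3⟩ := hD.leaf hp (v := v) (u := u) fun w hw => by
    rcases isChild_or (r := r) hT hw with h | h
    · exact absurd h (hv w)
    · exact h.unique hT huv
  exact ⟨h1, h3⟩

/-- `c` has children, all of which are leaves. -/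
structure IsStarVertex (T : SimpleGraph V) (r c : V) : Prop where
  exists_child : ∃ a, IsChild T r c a
  childless : ∀ a, IsChild T r c a → ∀ a', ¬ IsChild T r a a'

namespace IsStarVertex

variable {b c : V}

theorem notMem (hc : IsStarVertex T r c) (hD : IsTight p T D) (hp : 3 ≤ p) (hT : T.IsTree) :
    c ∉ D := by
  obtain ⟨a, ha⟩ := hc.exists_child
  exact (hD.childless hp hT ha (hc.childless a ha)).2.1

theorem domCount_eq (hc : IsStarVertex T r c) (hD : IsTight p T D) (hp : 3 ≤ p)
    (hT : T.IsTree) : domCount T D c = p := by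
  obtain ⟨a, ha⟩ := hc.exists_child
  exact (hD.childless hp hT ha (hc.childless a ha)).2.2

theorem child_mem (hc : IsStarVertex T r c) (hD : IsTight p T D) (hp : 3 ≤ p) (hT : T.IsTree)
    {a : V} (ha : IsChild T r c a) : a ∈ D :=
  (hD.childless hp hT ha (hc.childless a ha)).1

theorem mem_privateNbrs (hc : IsStarVertex T r c) (hD : IsTight p T D) (hp : 3 ≤ p)
    (hT : T.IsTree) (hbc : IsChild T r b c) : c ∈ privateNbrs p T D b :=
  ⟨hc.notMem hD hp hT, hbc.1, hc.domCount_eq hD hp hT⟩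

/-- The `p` marked neighbours of `c` are its children, plus its parent if that is marked. This gives
`p` children here and `p - 1` in `ncard_children_of_mem`, the stars of 𝒪₂ and 𝒪₁. -/
theorem ncard_children_of_notMem (hc : IsStarVertex T r c) (hD : IsTight p T D) (hp : 3 ≤ p)
    (hT : T.IsTree) (hbc : IsChild T r b c) (hb : b ∉ D) : {a | IsChild T r c a}.ncard = p := by
  rw [← hc.domCount_eq hD hp hT, domCount]
  congr 1
  ext a
  constructor
  · intro ha
    exact ⟨ha.1, hc.child_mem hD hp hT ha⟩
  · rintro ⟨ha, haD⟩
    rcases isChild_or (r := r) hT ha with h | h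
    · exact h
    · exact absurd (h.unique hT hbc ▸ haD) hb

theorem ncard_children_of_mem (hc : IsStarVertex T r c) (hD : IsTight p T D) (hp : 3 ≤ p)
    (hT : T.IsTree) (hbc : IsChild T r b c) (hb : b ∈ D) :
    {a | IsChild T r c a}.ncard = p - 1 := by
  have h1 : T.neighborSet c ∩ D = insert b {a | IsChild T r c a} := by
    ext a
    constructor
    · rintro ⟨ha, haD⟩
      rcases isChild_or (r := r) hT ha with h | h
      · exact Or.inr h
      · exact Or.inl (h.unique hT hbc)
    · rintro (rfl | ha)
      · exact ⟨hbc.1.symm, hb⟩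
      · exact ⟨ha.1, hc.child_mem hD hp hT ha⟩
  have h2 := hc.domCount_eq hD hp hT
  rw [domCount, h1, Set.ncard_insert_of_notMem] at h2
  · omega
  · intro h
    have h3 := h.2
    have h4 := hbc.2
    omega

theorem exists_embedding (hc : IsStarVertex T r c) (hD : IsTight p T D) (hp : 3 ≤ p)
    (hT : T.IsTree) {m : ℕ} (hm : {a | IsChild T r c a}.ncard = m) :
    ∃ φ : starK m ↪g T, φ (Sum.inl ()) = c ∧ Set.range φ = desc T r c ∧
      φ ⁻¹' D = Set.range Sum.inr := by
  obtain ⟨f, hf, hfr⟩ := exists_enumeration hm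
  have hfc : ∀ i, IsChild T r c (f i) := fun i => by
    have : f i ∈ Set.range f := ⟨i, rfl⟩
    rwa [hfr] at this
  obtain ⟨φ, h1, h2⟩ := exists_starK_embedding hT c hf fun i => (hfc i).1
  refine ⟨φ, h1, Set.Subset.antisymm ?_ (desc_subset ⟨_, h1⟩ ?_), ?_⟩
  · rintro _ ⟨⟨⟩ | i, rfl⟩
    · rw [h1]
      exact self_mem_desc c
    · rw [h2]
      exact desc_child (self_mem_desc c) (hfc i)
  · rintro _ ⟨⟨⟩ | i, rfl⟩ b hb
    · rw [h1] at hb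
      obtain ⟨i, rfl⟩ : b ∈ Set.range f := by rw [hfr]; exact hb
      exact ⟨_, h2 i⟩
    · rw [h2] at hb
      exact absurd hb (hc.childless _ (hfc i) b)
  · ext (⟨⟩ | i)
    · simp [h1, hc.notMem hD hp hT]
    · simp [h2, hc.child_mem hD hp hT (hfc i)]

end IsStarVertex

/-- A childless child would force `b ∉ D`, and the depth bound leaves only two levels below `b`. -/
theorem isStarVertex_of_isChild (hD : IsTight p T D) (hp : 3 ≤ p) (hT : T.IsTree) {b c : V}
    (hM : ∀ v, T.dist r v ≤ T.dist r b + 2) (hb : b ∈ D) (hbc : IsChild T r b c) :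
    IsStarVertex T r c where
  exists_child := by
    by_contra! h
    exact (hD.childless hp hT hbc h).2.1 hb
  childless a ha a' ha' := by
    have h1 := hM a'
    have h2 := hbc.2
    have h3 := ha.2
    have h4 := ha'.2
    omega

/-- Every smaller induced subtree with a tight set is constructible. -/
def SmallerConstructible (p : ℕ) (T : SimpleGraph V) (D : Set V) : Prop :=
  ∀ S : Set V, S ≠ Set.univ → (T.induce S).IsTree →
    IsTight p (T.induce S) (Subtype.val ⁻¹' D) → Constructible p (T.induce S) (Subtype.val ⁻¹' D)

/-- Undoes 𝒪₂: an unmarked `b` has no tightness condition, and losing the unmarked `c` does not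
affect its domination. -/
theorem constructible_of_star_notMem (hD : IsTight p T D) (hp : 3 ≤ p) (hT : T.IsTree)
    (IH : SmallerConstructible p T D) {b c : V} (hc : IsStarVertex T r c)
    (hbc : IsChild T r b c) (hb : b ∉ D) : Constructible p T D := by
  obtain ⟨φ, h1, h2, h3⟩ :=
    hc.exists_embedding hD hp hT (hc.ncard_children_of_notMem hD hp hT hbc hb)
  refine constructible_of_desc hT hD IH hbc (fun h => absurd h (hc.notMem hD hp hT))
    (fun h => absurd h hb) φ h1 h2 fun y hB hy _ => ?_
  rw [h3, ← leafSet_starK (by omega)]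
  exact Built.op₂ hB y fun h => hb (hy.1 h)

/-- Undoes 𝒪₁: `b` loses the private neighbour `c`, and `hpn` says that it has one to spare. -/
theorem constructible_of_star_mem (hD : IsTight p T D) (hp : 3 ≤ p) (hT : T.IsTree)
    (IH : SmallerConstructible p T D) {b c : V} (hc : IsStarVertex T r c)
    (hbc : IsChild T r b c) (hb : b ∈ D)
    (hpn : domCount T D b + 2 ≤ (privateNbrs p T D b).ncard) : Constructible p T D := by
  obtain ⟨φ, h1, h2, h3⟩ :=
    hc.exists_embedding hD hp hT (hc.ncard_children_of_mem hD hp hT hbc hb)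
  refine constructible_of_desc hT hD IH hbc (fun h => absurd h (hc.notMem hD hp hT))
    (fun _ _ => by omega) φ h1 h2 fun y hB hy _ => ?_
  rw [h3, ← leafSet_starK (by omega)]
  exact Built.op₁ hB y (hy.2 hb)

theorem domCount_eq_zero_of_star_children (hD : IsTight p T D) (hp : 3 ≤ p) (hT : T.IsTree)
    {a b : V} (hab : IsChild T r a b) (ha : a ∉ D)
    (hstar : ∀ c, IsChild T r b c → IsStarVertex T r c) : domCount T D b = 0 := by
  rw [domCount, Set.ncard_eq_zero, Set.eq_empty_iff_forall_notMem]
  rintro c ⟨hbc, hc⟩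
  rcases isChild_or (r := r) hT hbc with h | h
  · exact (hstar c h).notMem hD hp hT hc
  · exact ha (h.unique hT hab ▸ hc)

/-- Undoes 𝒪₃: the only marked neighbour of `b` is `a` and its private neighbours are its children,
so tightness and `hpn` leave exactly two children, each with `p - 1` leaves. -/
theorem constructible_of_treeF (hD : IsTight p T D) (hp : 3 ≤ p) (hT : T.IsTree)
    (IH : SmallerConstructible p T D) {a b : V} (hab : IsChild T r a b) (ha : a ∈ D) (hb : b ∈ D)
    (hstar : ∀ c, IsChild T r b c → IsStarVertex T r c)
    (hpn : (privateNbrs p T D b).ncard ≤ domCount T D b + 1) : Constructible p T D := by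
  have h1 : domCount T D b = 1 := by
    rw [domCount, ← Set.ncard_singleton a]
    congr 1
    ext c
    constructor
    · rintro ⟨hbc, hc⟩
      rcases isChild_or (r := r) hT hbc with h | h
      · exact absurd hc ((hstar c h).notMem hD hp hT)
      · exact h.unique hT hab
    · rintro rfl
      exact ⟨hab.1.symm, ha⟩
  have h2 : privateNbrs p T D b = {c | IsChild T r b c} := by
    ext c
    constructor
    · intro hc
      rcases isChild_or (r := r) hT hc.2.1 with h | h
      · exact h
      · exact absurd (h.unique hT hab ▸ ha) hc.1
    · intro hc
      exact (hstar c hc).mem_privateNbrs hD hp hT hc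
  have h3 := hD.tight b hb
  rw [h2] at h3 hpn
  obtain ⟨c₁, c₂, hne, hcs⟩ := Set.ncard_eq_two.1
    (show {c | IsChild T r b c}.ncard = 2 by omega)
  have hc₁ : IsChild T r b c₁ := by
    have : c₁ ∈ {c | IsChild T r b c} := by simp [hcs]
    exact this
  have hc₂ : IsChild T r b c₂ := by
    have : c₂ ∈ {c | IsChild T r b c} := by simp [hcs]
    exact this
  obtain ⟨φ, e0, e1, e2⟩ := exists_pathGraph_embedding hT hc₁.1 hc₂.1 hne
  have hφc : ∀ i : Fin 2, IsChild T r b (φ (![0, 2] i)) := by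
    intro i
    fin_cases i
    · simpa [e0] using hc₁
    · simpa [e2] using hc₂
  have henum : ∀ i : Fin 2, ∃ f : Fin (p - 1) → V, Function.Injective f ∧
      Set.range f = {v | IsChild T r (φ (![0, 2] i)) v} := fun i =>
    exists_enumeration ((hstar _ (hφc i)).ncard_children_of_mem hD hp hT (hφc i) hb)
  choose g hg hgr using henum
  have hgc : ∀ i j, IsChild T r (φ (![0, 2] i)) (g i j) := fun i j => by
    have : g i j ∈ Set.range (g i) := ⟨j, rfl⟩
    rwa [hgr] at this
  obtain ⟨φ', f1, f2⟩ := exists_attachLeaves_embedding hT φ ends_injective hgc hg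
    (L := T.dist r b + 2) (fun i j => by rw [(hgc i j).2, (hφc i).2]) (fun i => by
      fin_cases i
      · simp [e0, hc₁.2]
      · simp [e1]
      · simp [e2, hc₂.2])
  refine constructible_of_desc hT hD IH hab (fun _ => ha) (fun _ h => absurd hb h.1) φ'
    (x := Sum.inl 1) (by rw [f1, e1]) ?_ fun y hB hy hpn => ?_
  · refine Set.Subset.antisymm ?_ (desc_subset ⟨Sum.inl 1, by rw [f1, e1]⟩ ?_)
    · have hend : ∀ i, φ (![0, 2] i) ∈ desc T r b := fun i => desc_child (self_mem_desc b) (hφc i)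
      rintro _ ⟨i | ⟨i, j⟩, rfl⟩
      · rw [f1]
        fin_cases i
        · exact hend 0
        · simp only [Fin.mk_one, e1]
          exact self_mem_desc b
        · exact hend 1
      · rw [f2]
        exact desc_child (hend i) (hgc i j)
    · have hend : ∀ i v, IsChild T r (φ (![0, 2] i)) v → v ∈ Set.range φ' := by
        intro i v hv
        obtain ⟨j, rfl⟩ : v ∈ Set.range (g i) := by rw [hgr]; exact hv
        exact ⟨_, f2 i j⟩
      rintro _ ⟨i | ⟨i, j⟩, rfl⟩ v hv
      · rw [f1] at hv
        fin_cases i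
        · exact hend 0 v hv
        · simp only [Fin.mk_one, e1] at hv
          have : v ∈ {c | IsChild T r b c} := hv
          rw [hcs] at this
          rcases this with rfl | rfl
          · exact ⟨Sum.inl 0, by rw [f1, e0]⟩
          · exact ⟨Sum.inl 2, by rw [f1, e2]⟩
        · exact hend 1 v hv
      · rw [f2] at hv
        exact absurd hv ((hstar _ (hφc i)).childless _ (hgc i j) v)
  · have hpre : φ' ⁻¹' D = treeFSet (p - 1) := by
      ext (i | ⟨i, j⟩)
      · rw [Set.mem_preimage, f1]
        by_cases hi : i = 1
        · subst hi
          simp [treeFSet, e1, hb]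
        · refine iff_of_false ?_ (inl_notMem_treeFSet.2 hi)
          obtain ⟨j, rfl⟩ : ∃ j : Fin 2, ![0, 2] j = i := by revert i; decide
          exact (hstar _ (hφc j)).notMem hD hp hT
      · rw [Set.mem_preimage, f2]
        exact iff_of_true ((hstar _ (hφc i)).child_mem hD hp hT (hgc i j)) (by simp [treeFSet])
    rw [hpre]
    exact Built.op₃ hB y (hy.2 ha) (hpn hb) _ (isUniqueGammaSet_treeFSet hp)

/-- A child `b` of an overdominated vertex `a` outside `D` is the top of a leg of some
`F_{t,p-1}`, unless some smaller piece can be removed. -/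
theorem leg_of_not_constructible (hD : IsTight p T D) (hp : 3 ≤ p) (hT : T.IsTree)
    (IH : SmallerConstructible p T D) (hnot : ¬ Constructible p T D) {a b : V}
    (hM : ∀ v, T.dist r v ≤ T.dist r a + 3) (hab : IsChild T r a b) (ha : a ∉ D)
    (hac : p < domCount T D a) :
    b ∈ D ∧ ∃ w, {v | IsChild T r b v} = {w} ∧ IsStarVertex T r w := by
  have hM' : ∀ v, T.dist r v ≤ T.dist r b + 2 := fun v => by
    have h1 := hM v
    have h2 := hab.2
    omega
  have hex : ∃ c, IsChild T r b c := by
    by_contra! h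
    have := (hD.childless hp hT hab h).2.2
    omega
  by_cases hb : b ∈ D
  · have hstar : ∀ c, IsChild T r b c → IsStarVertex T r c := fun c hc =>
      isStarVertex_of_isChild hD hp hT hM' hb hc
    have h0 := domCount_eq_zero_of_star_children hD hp hT hab ha hstar
    obtain ⟨c, hc⟩ := hex
    refine ⟨hb, c, ?_, hstar c hc⟩
    -- Having no marked neighbour, `b` could spare one of two private neighbours, and 𝒪₁ could be
    -- undone.
    have hle : (privateNbrs p T D b).ncard ≤ 1 := by
      by_contra hle
      exact hnot (constructible_of_star_mem hD hp hT IH (hstar c hc) hc hb (by omega))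
    refine Set.Subset.antisymm (fun v hv => ?_) (Set.singleton_subset_iff.2 hc)
    exact (Set.ncard_le_one_iff (Set.toFinite _)).1 hle ((hstar v hv).mem_privateNbrs hD hp hT hv)
      ((hstar c hc).mem_privateNbrs hD hp hT hc)
  · exfalso
    apply hnot
    by_cases hs : IsStarVertex T r b
    · exact constructible_of_star_notMem hD hp hT IH hs hab ha
    -- Some child `c` of `b` has children; by the depth bound it is a star vertex below the unmarked
    -- `b`, so 𝒪₂ can be undone.
    · have : ¬ ∀ c, IsChild T r b c → ∀ c', ¬ IsChild T r c c' := fun h => hs ⟨hex, h⟩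
      push Not at this
      obtain ⟨c, hc, c', hc'⟩ := this
      refine constructible_of_star_notMem hD hp hT IH ⟨⟨c', hc'⟩, fun d hd d' hd' => ?_⟩ hc hb
      have h1 := hM' d'
      have h2 := hc.2
      have h3 := hd.2
      have h4 := hd'.2
      omega

/-- Undoes 𝒪₄: if no star can be removed below `a`, every child of `a` is the top of a leg, and the
descendants of `a` form an F_{t,p-1}. -/
theorem constructible_of_treeFTwo (hD : IsTight p T D) (hp : 3 ≤ p) (hT : T.IsTree)
    (IH : SmallerConstructible p T D) {z a : V} (hza : IsChild T r z a)
    (hM : ∀ v, T.dist r v ≤ T.dist r a + 3) (ha : a ∉ D) (hac : p < domCount T D a) :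
    Constructible p T D := by
  by_contra hnot
  have hleg : ∀ b, IsChild T r a b → b ∈ D ∧ ∃ w, {v | IsChild T r b v} = {w} ∧
      IsStarVertex T r w := fun b hab => leg_of_not_constructible hD hp hT IH hnot hM hab ha hac
  obtain ⟨t, hcard⟩ : ∃ t, {b | IsChild T r a b}.ncard = t := ⟨_, rfl⟩
  -- At most one of the more than `p` marked neighbours of `a` is its parent.
  have ht : p ≤ t := by
    have : T.neighborSet a ∩ D ⊆ insert z {b | IsChild T r a b} := by
      rintro v ⟨hv, -⟩
      rcases isChild_or (r := r) hT hv with h | h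
      · exact Or.inr h
      · exact Or.inl (h.unique hT hza)
    have h1 := (Set.ncard_le_ncard this).trans (Set.ncard_insert_le _ _)
    rw [← domCount] at h1
    omega
  obtain ⟨g, hg, hgr⟩ := exists_enumeration hcard
  have hgc : ∀ i, IsChild T r a (g i) := fun i => by
    have : g i ∈ Set.range g := ⟨i, rfl⟩
    rwa [hgr] at this
  choose w hw hws using fun i => (hleg _ (hgc i)).2
  have hgD : ∀ i, g i ∈ D := fun i => (hleg _ (hgc i)).1
  have hwc : ∀ i, IsChild T r (g i) (w i) := fun i => by
    have : w i ∈ {v | IsChild T r (g i) v} := by simp [hw]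
    exact this
  have henum : ∀ i : Fin t, ∃ f : Fin (p - 1) → V, Function.Injective f ∧
      Set.range f = {v | IsChild T r (w i) v} := fun i =>
    exists_enumeration ((hws i).ncard_children_of_mem hD hp hT (hwc i) (hgD i))
  choose f hf hfr using henum
  have hfc : ∀ i j, IsChild T r (w i) (f i j) := fun i j => by
    have : f i j ∈ Set.range (f i) := ⟨j, rfl⟩
    rwa [hfr] at this
  obtain ⟨φ₁, a1, a2⟩ := exists_starK_embedding hT a hg fun i => (hgc i).1
  obtain ⟨φ₂, b1, b2⟩ := exists_attachLeaves_embedding hT (r := r) φ₁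
    (f := (Sum.inr : Fin t → Unit ⊕ Fin t)) Sum.inr_injective (m := 1) (g := fun i _ => w i)
    (fun i _ => by rw [a2]; exact hwc i) (fun i => Function.injective_of_subsingleton _)
    (L := T.dist r a + 2) (fun i _ => by rw [(hwc i).2, (hgc i).2]) (by
      rintro (⟨⟩ | i)
      · rw [a1]; omega
      · rw [a2, (hgc i).2]; omega)
  obtain ⟨φ, c1, c2⟩ := exists_attachLeaves_embedding hT (r := r) φ₂ (foot_injective t)
    (m := p - 1) (g := f) (fun i j => by rw [b2]; exact hfc i j) hf
    (L := T.dist r a + 3) (fun i j => by rw [(hfc i j).2, (hwc i).2, (hgc i).2]) (by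
      rintro ((⟨⟩ | i) | ⟨i, j⟩)
      · rw [b1, a1]; omega
      · rw [b1, a2, (hgc i).2]; omega
      · rw [b2, (hwc i).2, (hgc i).2]; omega)
  have d1 : φ (Sum.inl (Sum.inl (Sum.inl ()))) = a := by rw [c1, b1, a1]
  have d2 : ∀ i, φ (Sum.inl (Sum.inl (Sum.inr i))) = g i := fun i => by rw [c1, b1, a2]
  have d3 : ∀ i j, φ (Sum.inl (Sum.inr (i, j))) = w i := fun i j => by rw [c1, b2]
  have m1 : ∀ i, g i ∈ desc T r a := fun i => desc_child (self_mem_desc a) (hgc i)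
  have m2 : ∀ i, w i ∈ desc T r a := fun i => desc_child (m1 i) (hwc i)
  refine hnot (constructible_of_desc hT hD IH hza (fun h => absurd h ha) (fun _ h => ?_) φ
    d1 ?_ fun y hB hy _ => ?_)
  -- The overdominated `a` is private for nobody, so `z` loses no private neighbour.
  · have : domCount T D a = p := h.2.2
    omega
  · refine Set.Subset.antisymm ?_ (desc_subset ⟨_, d1⟩ ?_)
    · rintro _ ⟨((⟨⟩ | i) | ⟨i, j⟩) | ⟨i, j⟩, rfl⟩
      · rw [d1]
        exact self_mem_desc a
      · rw [d2]
        exact m1 i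
      · rw [d3]
        exact m2 i
      · rw [c2]
        exact desc_child (m2 i) (hfc i j)
    · rintro _ ⟨((⟨⟩ | i) | ⟨i, j⟩) | ⟨i, j⟩, rfl⟩ v hv
      · rw [d1] at hv
        obtain ⟨i, rfl⟩ : v ∈ Set.range g := by rw [hgr]; exact hv
        exact ⟨_, d2 i⟩
      · rw [d2] at hv
        obtain rfl : v ∈ ({w i} : Set V) := by rw [← hw]; exact hv
        exact ⟨_, d3 i 0⟩
      · rw [d3] at hv
        obtain ⟨j, rfl⟩ : v ∈ Set.range (f i) := by rw [hfr]; exact hv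
        exact ⟨_, c2 i j⟩
      · rw [c2] at hv
        exact absurd hv ((hws i).childless _ (hfc i j) v)
  · have hpre : φ ⁻¹' D = treeFTwoSet t (p - 1) := by
      ext (((⟨⟩ | i) | ⟨i, j⟩) | ⟨i, j⟩)
      · simp [d1, ha, treeFTwoSet]
      · simp [d2, hgD, treeFTwoSet]
      · simp [d3, (hws i).notMem hD hp hT, treeFTwoSet]
      · simp [c2, (hws i).child_mem hD hp hT (hfc i j), treeFTwoSet]
    rw [hpre]
    exact Built.op₄ hB t ht y _ (isUniqueGammaSet_treeFTwoSet hp ht)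

/-- A tree in which all vertices are adjacent to `c`, the neighbours of `c` being marked. -/
theorem constructible_of_star (hT : T.IsTree) (hp : 3 ≤ p) {c : V} (hc : c ∉ D)
    (hdom : domCount T D c = p) (hall : ∀ v, v = c ∨ (T.Adj c v ∧ v ∈ D)) :
    Constructible p T D := by
  obtain ⟨f, hf, hfr⟩ := exists_enumeration (s := T.neighborSet c ∩ D) hdom
  have hfc : ∀ i, T.Adj c (f i) ∧ f i ∈ D := fun i => by
    have : f i ∈ Set.range f := ⟨i, rfl⟩
    rwa [hfr] at this
  obtain ⟨φ, h1, h2⟩ := exists_starK_embedding hT c hf fun i => (hfc i).1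
  have hsurj : Function.Surjective φ := by
    intro v
    rcases hall v with rfl | hv
    · exact ⟨_, h1⟩
    · obtain ⟨i, rfl⟩ : v ∈ Set.range f := by rw [hfr]; exact hv
      exact ⟨_, h2 i⟩
  let e : starK p ≃g T := RelIso.ofSurjective φ hsurj
  refine ⟨0, _, _, _, Built.base, e.symm, ?_⟩
  have : e.symm '' D = φ ⁻¹' D := e.symm.toEquiv.image_eq_preimage_symm D
  rw [this, leafSet_starK (by omega)]
  ext (⟨⟩ | i)
  · simp [h1, hc]
  · simp [h2, (hfc i).2]

theorem IsTight.constructible_of_smaller (hD : IsTight p T D) (hp : 3 ≤ p) (hT : T.IsTree)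
    (IH : SmallerConstructible p T D) : Constructible p T D := by
  classical
  have := Fintype.ofFinite V
  have hnt : Nontrivial V := by
    obtain ⟨v⟩ := hT.connected.nonempty
    by_contra h
    rw [not_nontrivial_iff_subsingleton] at h
    -- In a one-vertex tree the only candidate for a private neighbour would be the vertex itself.
    obtain ⟨-, h2, -⟩ := hD.leaf hp (v := v) (u := v) fun w _ => Subsingleton.elim _ _
    exact h2.ne rfl
  -- Rooting at a leaf makes the root marked, so every unmarked vertex has a parent; it also gives
  -- the root a single child.
  obtain ⟨r, hr⟩ := hT.exists_vert_degree_one_of_nontrivial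
  obtain ⟨u, -, hu⟩ := SimpleGraph.degree_eq_one_iff_existsUnique_adj.1 hr
  obtain ⟨hrD, hru, -, -⟩ := hD.leaf hp (v := r) (u := u) hu
  obtain ⟨v₀, hM⟩ := Finite.exists_max (T.dist r)
  have hv₀ : v₀ ≠ r := by
    rintro rfl
    have h1 := hM u
    have h2 := hT.connected.pos_dist_of_ne hru.ne
    rw [SimpleGraph.dist_self] at h1
    omega
  obtain ⟨v₁, h01⟩ := exists_isChild hT hv₀
  have d01 := h01.2
  have hs₁ : IsStarVertex T r v₁ := by
    refine ⟨⟨v₀, h01⟩, fun a ha a' ha' => ?_⟩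
    have h1 := hM a'
    have h2 := ha.2
    have h3 := ha'.2
    omega
  have hv₁ : v₁ ∉ D := hs₁.notMem hD hp hT
  obtain ⟨v₂, h12⟩ := exists_isChild hT (r := r) (u := v₁) (by rintro rfl; exact hv₁ hrD)
  have d12 := h12.2
  by_cases hv₂ : v₂ ∈ D
  swap
  · exact constructible_of_star_notMem hD hp hT IH hs₁ h12 hv₂
  have hstar : ∀ c, IsChild T r v₂ c → IsStarVertex T r c := fun c hc =>
    isStarVertex_of_isChild hD hp hT (fun v => by have := hM v; omega) hv₂ hc
  by_cases hr₂ : v₂ = r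
  · subst hr₂
    -- Here the depth is two and `v₁` is the only child of the root, so the tree is a star centred
    -- at `v₁`.
    refine constructible_of_star hT hp hv₁ (hs₁.domCount_eq hD hp hT) fun v => ?_
    rw [SimpleGraph.dist_self] at d12
    obtain rfl := hu v₁ h12.1
    by_cases hv : v = v₂
    · subst hv
      exact Or.inr ⟨h12.1.symm, hv₂⟩
    obtain ⟨q, hq⟩ := exists_isChild hT hv
    by_cases hq₂ : q = v₂
    · subst hq₂
      exact Or.inl (hu v hq.1)
    obtain ⟨q', hq'⟩ := exists_isChild hT hq₂
    have hq0 : T.dist v₂ q' = 0 := by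
      have h1 := hM v
      have h2 := hq.2
      have h3 := hq'.2
      omega
    obtain rfl := hT.connected.dist_eq_zero_iff.1 hq0
    obtain rfl := hu q hq'.1
    exact Or.inr ⟨hq.1, hs₁.child_mem hD hp hT hq⟩
  obtain ⟨v₃, h23⟩ := exists_isChild hT hr₂
  have d23 := h23.2
  by_cases hpn : domCount T D v₂ + 2 ≤ (privateNbrs p T D v₂).ncard
  · exact constructible_of_star_mem hD hp hT IH hs₁ h12 hv₂ hpn
  by_cases hv₃ : v₃ ∈ D
  · exact constructible_of_treeF hD hp hT IH h23 hv₃ hv₂ hstar (by omega)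
  obtain ⟨v₄, h34⟩ := exists_isChild hT (r := r) (u := v₃) (by rintro rfl; exact hv₃ hrD)
  have h0 := domCount_eq_zero_of_star_children hD hp hT h23 hv₃ hstar
  refine constructible_of_treeFTwo hD hp hT IH h34 (fun v => by have := hM v; omega) hv₃ ?_
  -- With exactly `p` marked neighbours, `v₃` would be a private neighbour of `v₂` besides `v₁`, but
  -- `h0` and the failure of `hpn` allow only one.
  refine lt_of_le_of_ne (hD.dom _ hv₃) fun heq => ?_
  have : v₃ = v₁ := (Set.ncard_le_one_iff (Set.toFinite _)).1 (show (privateNbrs p T D v₂).ncard ≤ 1 by omega)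
    ⟨hv₃, h23.1.symm, heq.symm⟩ (hs₁.mem_privateNbrs hD hp hT h12)
  subst this
  omega

end Reduction

/-- Every tree with a tight set can be built. -/
theorem IsTight.constructible {p : ℕ} (hp : 3 ≤ p) {V : Type} [Finite V] {T : SimpleGraph V}
    {D : Set V} (hT : T.IsTree) (hD : IsTight p T D) : Constructible p T D := by
  obtain ⟨n, hn⟩ : ∃ n, Nat.card V = n := ⟨_, rfl⟩
  induction n using Nat.strong_induction_on generalizing V with
  | _ n ih =>
    refine hD.constructible_of_smaller hp hT fun S hS hT' hD' => ih _ ?_ hT' hD' rfl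
    rw [← hn, ← Set.ncard_univ V]
    exact Set.ncard_lt_ncard (Set.ssubset_univ_iff.2 hS)

/-- The construction and the induction live in `Type`; a finite vertex type of any universe is moved
there by numbering its vertices. -/
theorem IsTight.constructible_univ {p : ℕ} (hp : 3 ≤ p) {V : Type*} [Finite V]
    {T : SimpleGraph V} {D : Set V} (hT : T.IsTree) (hD : IsTight p T D) :
    Constructible p T D := by
  let ε : V ≃ Fin (Nat.card V) := Finite.equivFin V
  let e := SimpleGraph.Iso.map ε T
  obtain ⟨k, W, G, A, hB, f, hf⟩ := (hD.iso e).constructible hp (e.isTree_iff.1 hT)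
  exact ⟨k, W, G, A, hB, e.trans f, by rw [← hf, ← Set.image_comp]; rfl⟩

theorem InFamilyWith.isTight {p : ℕ} (hp : 3 ≤ p) {V : Type*} [Finite V] {T : SimpleGraph V}
    {A : Set V} (h : InFamilyWith p T A) : IsTight p T A ∧ p < A.ncard := by
  obtain ⟨k, hk, W, G, A', hB, e, rfl⟩ := h
  refine ⟨?_, ?_⟩
  · have := (hB.isTight hp).iso e.symm
    rwa [← Set.image_comp, show (e.symm : W → V) ∘ e = id from funext e.symm_apply_apply,
      Set.image_id] at this
  · have := hB.add_le_ncard hp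
    rw [Set.ncard_image_of_injective _ e.injective] at this
    omega

end PReinforcement

theorem theorem4p4 (p : ℕ) (hp : 3 ≤ p) {V : Type*} [Finite V] (T : SimpleGraph V)
    (hT : T.IsTree) :
    PReinforcement.reinfNum p T ≤ p + 1 ∧
    (PReinforcement.reinfNum p T = p + 1 ↔ PReinforcement.InFamily p T) ∧
    (∀ A : Set V, PReinforcement.InFamilyWith p T A → PReinforcement.IsUniqueGammaSet p T A) := by
  have := Fintype.ofFinite V
  refine ⟨PReinforcement.reinfNum_le_succ (by omega) hT, ⟨fun h => ?_, ?_⟩, fun A hA =>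
    (hA.isTight hp).1.isUniqueGammaSet hp hT⟩
  · obtain ⟨hg, D, hD, hDc⟩ := PReinforcement.exists_isTight_of_reinfNum_eq h
    obtain ⟨k, W, G, A, hB, e, he⟩ := hD.constructible_univ hp hT
    refine ⟨D, k, Nat.one_le_iff_ne_zero.2 ?_, W, G, A, hB, e, he⟩
    -- Without any operation the marked set has exactly `p` elements, contrary to `γ_p > p`.
    rintro rfl
    have := hB.ncard_zero hp
    rw [← he, Set.ncard_image_of_injective _ e.injective] at this
    omega
  · rintro ⟨A, hA⟩
    obtain ⟨h1, h2⟩ := hA.isTight hp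
    exact h1.reinfNum_eq hp hT h2
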